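/- Let $K$ be a field and let $\Lambda$ be a finite-dimensional symmetric $K$-algebra, i.e. there is a $K$-linear form $\nu:\Lambda\to K$ with $\nu(ab)=\nu(ba)$ for all $a,b\in\Lambda$ whose kernel contains no nonzero left or right ideal. Assume that the Jacobson radical $J$ of $\Lambda$ satisfies $J^3=0$. For a graph $X$ say that $\Lambda$ is of type $X$ if the isomorphism classes of simple $\Lambda$-modules are represented by modules $S_i$ indexed by the vertices $i$ of $X$ in such a way that $\dim_K\operatorname{Ext}^1_\Lambda(S_i,S_j)$ is the number of edges of $X$ between $i$ and $j$, for all $i,j$ (a loop at $i$ counts once for $i=j$). Suppose that $\Lambda$ is of one of the following types, with the number $q$ attached to it: - $\widetilde A_n$, $n\ge 2$ (the cycle with $n+1$ vertices): $q=n+1$; - $\widetilde D_n$, $n\ge 4$ (with $n+1$ vertices): $q=2n-4$ if $n$ is even, $q=8n-16$ if $n$ is odd; - $\widetilde E_6$, $\widetilde E_7$, $\widetilde E_8$ (with $7$, $8$, $9$ vertices): $q=12$, $q=72$, $q=60$ respectively; - $\widetilde{DL}_n$, $n\ge 3$ (the graph with vertices $1,\dots,n$, edges $\{1,3\}$, $\{2,3\}$,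 $\{i,i+1\}$ for $3\le i\le n-1$, and one loop at $n$): $q=8n-12$. Let $S$ be a simple $\Lambda$-module and let $\cdots\to R_1\to R_0\to S\to 0$ be a minimal projective resolution of $S$, i.e. a projective resolution such that the image of $R_{m+1}\to R_m$ is contained in $\operatorname{rad}R_m$ for all $m\ge 0$. Then this resolution is of linear growth of factor $q$: for every $l$ with $0\le l\le q-1$ there is a $\Lambda$-module $N_l$, which is a (finite, nonempty) direct sum of terms $R_i$ with $0\le i\le q$, such that $$R_{kq+l}\;\cong\;N_l^{\oplus k}\oplus R_l\qquad\text{for all }k\ge 0 .$$ -/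

import Mathlib

open CategoryTheory

universe u v

/-- The extended Dynkin diagrams `Ã_n` (`n ≥ 2`), `D̃_n` (`n ≥ 4`), `Ẽ_6`, `Ẽ_7`, `Ẽ_8`,
and the diagrams `D̃L_n` (`n ≥ 3`). -/
inductive TameDiagram : Type
  | A (n : ℕ) (hn : 2 ≤ n)
  | D (n : ℕ) (hn : 4 ≤ n)
  | E6
  | E7
  | E8
  | DL (n : ℕ) (hn : 3 ≤ n)

namespace TameDiagram

/-- The number of vertices of the diagram. -/
def numVertices : TameDiagram → ℕ
  | A n _ => n + 1
  | D n _ => n + 1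
  | E6 => 7
  | E7 => 8
  | E8 => 9
  | DL n _ => n

/-- The edges of the diagram, each listed in one orientation, on the vertex labels
`1, 2, …, numVertices`. The pair `(n, n)` for `DL n` is a loop. -/
def Edge : TameDiagram → ℕ → ℕ → Prop
  | A n _, i, j => j = i + 1 ∨ (i = 1 ∧ j = n + 1)
  | D n _, i, j => (i = 1 ∧ j = 3) ∨ (i = 2 ∧ j = 3) ∨ (3 ≤ i ∧ j = i + 1 ∧ j < n) ∨
      (i + 1 = n ∧ j = n) ∨ (i + 1 = n ∧ j = n + 1)
  | E6, i, j => (i, j) ∈ [(1, 2), (2, 3), (3, 4), (4, 5), (3, 6), (6, 7)]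
  | E7, i, j => (i, j) ∈ [(8, 1), (1, 2), (2, 3), (3, 4), (4, 5), (5, 6), (3, 7)]
  | E8, i, j => (i, j) ∈ [(1, 2), (2, 3), (3, 4), (4, 5), (5, 6), (6, 7), (7, 9), (3, 8)]
  | DL n _, i, j => (i = 1 ∧ j = 3) ∨ (i = 2 ∧ j = 3) ∨ (3 ≤ i ∧ j = i + 1) ∨ (i = n ∧ j = n)

open Classical in
/-- The adjacency matrix: the `(i, j)` entry is the number of edges between `i` and `j`.
No two edges of these diagrams are parallel, and a loop contributes `1` to its diagonal entry.
The index `i : Fin X.numVertices` stands for the vertex with label `i + 1`. -/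
noncomputable def adjacency (X : TameDiagram) :
    Matrix (Fin X.numVertices) (Fin X.numVertices) ℕ :=
  Matrix.of fun i j =>
    if X.Edge (i.val + 1) (j.val + 1) ∨ X.Edge (j.val + 1) (i.val + 1) then 1 else 0

/-- The growth factor attached to the diagram. -/
def q : TameDiagram → ℕ
  | A n _ => n + 1
  | D n _ => if Even n then 2 * n - 4 else 8 * n - 16
  | E6 => 12
  | E7 => 72
  | E8 => 60
  | DL n _ => 8 * n - 12

end TameDiagram

/-- A symmetric `K`-algebra (in the sense of symmetric Frobenius algebras): there is a linear form `ν` with `ν (a * b) = ν (b * a)` whose kernel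
contains no nonzero left ideal and no nonzero right ideal. -/
def IsSymmetricFrobeniusAlgebra (K : Type u) (Λ : Type v) [Field K] [Ring Λ] [Algebra K Λ] : Prop :=
  ∃ ν : Λ →ₗ[K] K, (∀ a b : Λ, ν (a * b) = ν (b * a)) ∧
    (∀ I : Submodule Λ Λ, (∀ x ∈ I, ν x = 0) → I = ⊥) ∧
    (∀ I : Submodule Λᵐᵒᵖ Λ, (∀ x ∈ I, ν x = 0) → I = ⊥)

/-- The underlying diagram of the quiver of `Λ` is `X`: the isomorphism classes of simple
`Λ`-modules are represented by modules `S i` indexed by the vertices of `X`, and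
`dim_K Ext¹(S i, S j)` is the number of edges of `X` between `i` and `j`. -/
def IsOfType (K : Type u) (Λ : Type v) [Field K] [Ring Λ] [Algebra K Λ] (X : TameDiagram) :
    Prop :=
  ∃ S : Fin X.numVertices → ModuleCat.{v} Λ,
    (∀ i, IsSimpleModule Λ (S i)) ∧
    (∀ i j, Nonempty (S i ≃ₗ[Λ] S j) → i = j) ∧
    (∀ T : ModuleCat.{v} Λ, IsSimpleModule Λ T → ∃ i, Nonempty (T ≃ₗ[Λ] S i)) ∧
    (∀ i j, Module.rank K (Abelian.Ext.{v} (S i) (S j) 1) = X.adjacency i j)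

/-- A projective resolution `⋯ → R₁ → R₀ → M → 0` is minimal if the image of every
`R (n + 1) → R n` lies in the radical of `R n`. (By exactness this includes the statement that
the kernel of `R₀ → M` lies in the radical of `R₀`.) -/
def IsMinimalResolution {Λ : Type v} [Ring Λ] {M : ModuleCat.{v} Λ}
    (R : ProjectiveResolution M) : Prop :=
  ∀ n : ℕ, LinearMap.range (R.complex.d (n + 1) n).hom ≤ Module.jacobson Λ (R.complex.X n)

/-- A projective resolution is of linear growth of factor `p` if for every `0 ≤ l ≤ p - 1` there
is a module `N`, a (nonempty, finite) direct sum of terms `R i` with `0 ≤ i ≤ p`, such that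
`R (k * p + l) ≅ N ^ k ⊕ R l` for all `k`. -/
def HasLinearGrowth {Λ : Type v} [Ring Λ] {M : ModuleCat.{v} Λ}
    (R : ProjectiveResolution M) (p : ℕ) : Prop :=
  ∀ l < p, ∃ N : ModuleCat.{v} Λ,
    (∃ (m : ℕ) (i : Fin (m + 1) → ℕ), (∀ j, i j ≤ p) ∧
      Nonempty (N ≃ₗ[Λ] ((j : Fin (m + 1)) → R.complex.X (i j)))) ∧
    ∀ k : ℕ, Nonempty (R.complex.X (k * p + l) ≃ₗ[Λ] ((Fin k → N) × R.complex.X l))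

set_option linter.unusedSectionVars false

/-! Since `Λ` is self-injective and `J³ = 0`, each indecomposable projective `Λ (e j)` has three
layers: a simple top `S j`, a middle layer described by row `j` of the adjacency matrix `E`, and a
socle isomorphic to `S j`. Let `t n j` be the multiplicity of `Λ (e j)` in `R n`, and `Ω n` the
image of `R (n + 1) → R n`. If `J Ω n = J² R n`, then `Ω n` has composition vector `t (n + 1) + t
n`, and counting composition factors along the resolution gives `t (n + 2) + t n = t (n + 1) E`.
Hence `t n = t 0 · S_n(E)`, with `S_n` the rescaled Chebyshev polynomials of the second kind.

The equality `J Ω n = J² R n` rests on the positive vector `δ` with `E δ = 2 δ`. Weighing simples by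
`δ`, the layers of a projective weigh 1 : 2 : 1. The invariant `IsTopHeavy` (no quotient is heavier
in its radical than in its top) holds for simple modules and passes to syzygies (`isTopHeavy_ker`);
it forces the equality (`rad_ker_eq`), because otherwise some `I / soc I`, with layers 1 : 2, would
be a quotient.

For the growth, let `C_n` be the rescaled Chebyshev polynomials of the first kind. Each diagram
satisfies `C_q(E) = 2` and `C_{q-1}(E) = E` (`chebC_adj`), so `C_n(E)` has period `q` in `n`. As
`S_{n+2} - S_n = C_{n+2}`, the increment `S_{n+q}(E) - S_n(E)` depends only on the parity of `n`,
and for odd `q` not even on that (`chebS_add`, `chebS_sub_one_of_odd`). Therefore `t (k q + l) = k w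
+ t l`, with `w` equal to `t (q - 1)` or `t (q - 2) + t 0`. -/

namespace RadicalCube

/-! ### The radical filtration of a module when `J³ = 0`. -/

section Radical

variable {Λ M N : Type*} [Ring Λ] [AddCommGroup M] [Module Λ M] [AddCommGroup N] [Module Λ N]

/-- The radical `J N` of a submodule, where `J` is the Jacobson radical of the ring. -/
def rad (N : Submodule Λ M) : Submodule Λ M := Ring.jacobson Λ • N

theorem map_rad (f : M →ₗ[Λ] N) (X : Submodule Λ M) : (rad X).map f = rad (X.map f) :=
  Submodule.map_smul'' _ _ _

theorem rad_le (X : Submodule Λ M) : rad X ≤ X := Submodule.smul_le_right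

theorem rad_mono {X Y : Submodule Λ M} (h : X ≤ Y) : rad X ≤ rad Y := smul_mono_right _ h

theorem rad_sup (X Y : Submodule Λ M) : rad (X ⊔ Y) = rad X ⊔ rad Y := Submodule.smul_sup _ _ _

theorem map_rad_top_of_surjective {f : M →ₗ[Λ] N} (hf : Function.Surjective f) :
    (rad (⊤ : Submodule Λ M)).map f = rad ⊤ := by
  rw [map_rad, Submodule.map_top, LinearMap.range_eq_top.mpr hf]

theorem map_rad_top_le (f : M →ₗ[Λ] N) : (rad (⊤ : Submodule Λ M)).map f ≤ rad ⊤ := by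
  rw [map_rad]; exact rad_mono le_top

theorem map_subtype_rad_top (X : Submodule Λ M) :
    (rad (⊤ : Submodule Λ X)).map X.subtype = rad X := by
  rw [map_rad, Submodule.map_subtype_top]

theorem rad_rad_rad (hJ : Ring.jacobson Λ ^ 3 = ⊥) (X : Submodule Λ M) :
    rad (rad (rad X)) = ⊥ := by
  have : rad (rad (rad X)) = (Ring.jacobson Λ ^ 3) • X := by
    simp only [rad]
    rw [← Submodule.mul_smul, ← Submodule.mul_smul, (Ring.jacobson Λ).pow_succ (n := 2),
      (Ring.jacobson Λ).pow_succ (n := 1), Submodule.pow_one]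
  rw [this, hJ, Submodule.bot_smul]

/-- Nakayama's lemma from nilpotency, hence with no finiteness condition on `M`. If `X + Y = M` then
`J M = J X + J Y`, so `M = X + J M` becomes `M = X + J Y`; two passes starting at `Y = J M` reach
`J³ M = 0`. -/
theorem eq_top_of_sup_rad (hJ : Ring.jacobson Λ ^ 3 = ⊥) {X : Submodule Λ M}
    (h : X ⊔ rad ⊤ = ⊤) : X = ⊤ := by
  have key : ∀ Y : Submodule Λ M, X ⊔ Y = ⊤ → X ⊔ rad Y = ⊤ := by
    intro Y hY
    have h' : rad (⊤ : Submodule Λ M) = rad X ⊔ rad Y := by rw [← rad_sup, hY]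
    rw [eq_top_iff]
    refine h.ge.trans ?_
    rw [h']
    exact sup_le le_sup_left (sup_le ((rad_le X).trans le_sup_left) le_sup_right)
  have := key _ (key _ h)
  rwa [rad_rad_rad hJ, sup_bot_eq] at this

theorem surjective_of_range_sup_rad (hJ : Ring.jacobson Λ ^ 3 = ⊥) {f : M →ₗ[Λ] N}
    (h : LinearMap.range f ⊔ rad ⊤ = ⊤) : Function.Surjective f :=
  LinearMap.range_eq_top.mp (eq_top_of_sup_rad hJ h)

theorem isSemisimpleModule_of_rad [IsArtinianRing Λ] (h : rad (⊤ : Submodule Λ M) = ⊥) :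
    IsSemisimpleModule Λ M := by
  have h' : Module.IsTorsionBySet Λ M (Ring.jacobson Λ) := fun m a ↦ by
    have : (a : Λ) • m ∈ rad (⊤ : Submodule Λ M) := Submodule.smul_mem_smul a.2 trivial
    rwa [h] at this
  let _ := h'.module
  exact (h'.semilinearMap.isSemisimpleModule_iff_of_bijective Function.bijective_id).2
      inferInstance

theorem rad_top_of_isSemisimpleModule [IsSemisimpleModule Λ M] :
    rad (⊤ : Submodule Λ M) = ⊥ := by
  rw [eq_bot_iff, rad, Submodule.smul_le]
  intro r hr m _
  have := Module.mem_annihilator.mp (IsSemisimpleModule.jacobson_le_annihilator Λ M hr) m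
  simpa using this

theorem rad_top_quotient_rad : rad (⊤ : Submodule Λ (M ⧸ rad (⊤ : Submodule Λ M))) = ⊥ := by
  rw [← map_rad_top_of_surjective (Submodule.mkQ_surjective _), Submodule.mkQ_map_self]

theorem isSemisimpleModule_submodule [IsArtinianRing Λ] {X : Submodule Λ M} (h : rad X = ⊥) :
    IsSemisimpleModule Λ X := by
  apply isSemisimpleModule_of_rad
  apply Submodule.map_injective_of_injective X.injective_subtype
  rw [map_subtype_rad_top, h, Submodule.map_bot]

theorem isSemisimpleModule_top_quotient [IsArtinianRing Λ] :
    IsSemisimpleModule Λ (M ⧸ rad (⊤ : Submodule Λ M)) :=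
  isSemisimpleModule_of_rad rad_top_quotient_rad

/-- Translates minimality, stated through `Module.jacobson`, into containment in `J M`: the quotient
`M / J M` is semisimple, so its own radical vanishes. -/
theorem jacobson_le_rad [IsArtinianRing Λ] : Module.jacobson Λ M ≤ rad ⊤ := by
  have : IsSemisimpleModule Λ (M ⧸ rad (⊤ : Submodule Λ M)) := isSemisimpleModule_top_quotient
  exact Module.jacobson_le_of_eq_bot (IsSemisimpleModule.jacobson_eq_bot _ _)

theorem rad_pi {ι : Type*} [Finite ι] {M : ι → Type*} [∀ i, AddCommGroup (M i)]
    [∀ i, Module Λ (M i)] (X : ∀ i, Submodule Λ (M i)) :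
    rad (Submodule.pi Set.univ X) = Submodule.pi Set.univ fun i ↦ rad (X i) := by
  classical
  cases nonempty_fintype ι
  apply le_antisymm
  · rw [rad, Submodule.smul_le]
    intro r hr m hm i _
    exact Submodule.smul_mem_smul hr (hm i trivial)
  · intro m hm
    rw [← Finset.univ_sum_single m]
    refine Submodule.sum_mem _ fun i _ ↦ ?_
    have h : (rad (X i)).map (LinearMap.single Λ M i) ≤ rad (Submodule.pi Set.univ X) := by
      rw [map_rad]
      apply rad_mono
      rintro _ ⟨x, hx, rfl⟩ j _
      by_cases hj : j = i
      · subst hj; simpa using hx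
      · simp [Pi.single_eq_of_ne hj]
    exact h ⟨m i, hm i trivial, rfl⟩

end Radical

/-! ### Composition multiplicities as dimensions of `a M`. -/

section Multiplicity

variable (K : Type*) {Λ M N : Type*} [Field K] [Ring Λ] [Algebra K Λ]
  [AddCommGroup M] [Module Λ M] [Module K M] [IsScalarTower K Λ M]
  [AddCommGroup N] [Module Λ N] [Module K N] [IsScalarTower K Λ N]

/-- The dimension of `a M`. For a primitive idempotent `a` of a split algebra, this is the
multiplicity in `M` of the corresponding simple module. -/
noncomputable def mult (a : Λ) (M : Type*) [AddCommGroup M] [Module Λ M] [Module K M]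
    [IsScalarTower K Λ M] : ℕ :=
  Module.finrank K (LinearMap.range (Algebra.lsmul K K M a))

theorem mem_range_lsmul_iff {a : Λ} (ha : a * a = a) {m : M} :
    m ∈ LinearMap.range (Algebra.lsmul K K M a) ↔ a • m = m := by
  constructor
  · rintro ⟨m, rfl⟩
    simp [smul_smul, ha]
  · intro h
    exact ⟨m, h⟩

/-- For an idempotent `a`, the functor taking `M` to `a M` is exact. All counting of composition
factors below goes through this additivity. -/
theorem mult_ker_add {a : Λ} (ha : a * a = a) [FiniteDimensional K M] (f : M →ₗ[Λ] N) :
    mult K a (LinearMap.range f) + mult K a (LinearMap.ker f) = mult K a M := by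
  let g := ((f.rangeRestrict).restrictScalars K).comp
    (LinearMap.range (Algebra.lsmul K K M a)).subtype
  have hg := LinearMap.finrank_range_add_finrank_ker g
  have h1 : LinearMap.range g = LinearMap.range (Algebra.lsmul K K (LinearMap.range f) a) := by
    ext ⟨_, x, rfl⟩
    rw [mem_range_lsmul_iff K ha]
    constructor
    · rintro ⟨⟨y, hy⟩, h⟩
      rw [mem_range_lsmul_iff K ha] at hy
      rw [← h]
      change a • f.rangeRestrict y = f.rangeRestrict y
      rw [← map_smul, hy]
    · intro h
      refine ⟨⟨a • x, x, rfl⟩, ?_⟩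
      rw [← h]
      exact map_smul f.rangeRestrict a x
  have h2 : Module.finrank K (LinearMap.ker g) = mult K a (LinearMap.ker f) := by
    rw [mult, (Submodule.equivMapOfInjective (LinearMap.range (Algebra.lsmul K K M a)).subtype
      (Submodule.injective_subtype _) (LinearMap.ker g)).finrank_eq,
      (Submodule.equivMapOfInjective ((LinearMap.ker f).subtype.restrictScalars K)
      (Submodule.injective_subtype _)
        (LinearMap.range (Algebra.lsmul K K (LinearMap.ker f) a))).finrank_eq]
    refine congrArg (fun X : Submodule K M ↦ Module.finrank K X) ?_
    ext x
    constructor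
    · rintro ⟨⟨y, hy⟩, h, rfl⟩
      rw [mem_range_lsmul_iff K ha] at hy
      have h' : f y = 0 := congrArg Subtype.val h
      exact ⟨⟨y, h'⟩, (mem_range_lsmul_iff K ha).mpr (Subtype.ext hy), rfl⟩
    · rintro ⟨⟨y, hy⟩, h, rfl⟩
      replace h := (mem_range_lsmul_iff K ha).mp h
      exact ⟨⟨y, (mem_range_lsmul_iff K ha).mpr (congrArg Subtype.val h)⟩, Subtype.ext hy, rfl⟩
  rw [h1, h2] at hg
  exact hg

theorem mult_congr (a : Λ) (φ : M ≃ₗ[Λ] N) : mult K a M = mult K a N := by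
  rw [mult, mult, ((φ.restrictScalars K).submoduleMap _).finrank_eq]
  refine congrArg (fun X : Submodule K N ↦ Module.finrank K X) ?_
  ext x
  constructor
  · rintro ⟨_, ⟨y, rfl⟩, rfl⟩
    exact ⟨φ y, (map_smul φ a y).symm⟩
  · rintro ⟨y, rfl⟩
    refine ⟨a • φ.symm y, ⟨_, rfl⟩, ?_⟩
    change φ (a • φ.symm y) = a • y
    simp

instance finiteDimensional_submodule [FiniteDimensional K M] (X : Submodule Λ M) :
    FiniteDimensional K X :=
  Module.Finite.of_injective (X.subtype.restrictScalars K) X.injective_subtype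

theorem mult_submodule_add {a : Λ} (ha : a * a = a) [FiniteDimensional K M]
    (X : Submodule Λ M) : mult K a (M ⧸ X) + mult K a X = mult K a M := by
  rw [← mult_ker_add K ha X.mkQ]
  congr 1
  · exact mult_congr K a ((LinearEquiv.ofTop _ (Submodule.range_mkQ X)).symm)
  · exact mult_congr K a (LinearEquiv.ofEq _ _ (Submodule.ker_mkQ X).symm)

theorem mult_map_of_injective (a : Λ) {f : M →ₗ[Λ] N}
    (hf : Function.Injective f) (X : Submodule Λ M) : mult K a (X.map f) = mult K a X :=
  (mult_congr K a (Submodule.equivMapOfInjective f hf X)).symm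

theorem mult_map_add_ker {a : Λ} (ha : a * a = a) [FiniteDimensional K M] {f : M →ₗ[Λ] N}
    {X : Submodule Λ M} (h : LinearMap.ker f ≤ X) :
    mult K a (X.map f) + mult K a (LinearMap.ker f) = mult K a X := by
  have := mult_ker_add K ha (f.domRestrict X)
  rw [mult_congr K a (LinearEquiv.ofEq _ _ (LinearMap.range_domRestrict X f)),
    mult_congr K a (LinearEquiv.ofEq _ _ (show LinearMap.ker (f.domRestrict X) =
      (LinearMap.ker f).comap X.subtype by ext; simp)),
    mult_congr K a (Submodule.comapSubtypeEquivOfLe h)] at this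
  exact this

theorem mult_bot (a : Λ) : mult K a (⊥ : Submodule Λ M) = 0 :=
  Module.finrank_zero_of_subsingleton

/-- A product of submodules as a product of modules. -/
def submodulePiEquiv {R ι : Type*} [Ring R] {M : ι → Type*} [∀ i, AddCommGroup (M i)]
    [∀ i, Module R (M i)] (X : ∀ i, Submodule R (M i)) :
    Submodule.pi Set.univ X ≃ₗ[R] ∀ i, X i where
  toFun x i := ⟨x.1 i, x.2 i trivial⟩
  invFun x := ⟨fun i ↦ x i, fun i _ ↦ (x i).2⟩
  map_add' _ _ := rfl
  map_smul' _ _ := rfl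
  left_inv _ := rfl
  right_inv _ := rfl

theorem mult_pi (a : Λ) {ι : Type*} [Fintype ι] {M : ι → Type*} [∀ i, AddCommGroup (M i)]
    [∀ i, Module Λ (M i)] [∀ i, Module K (M i)] [∀ i, IsScalarTower K Λ (M i)]
    [∀ i, FiniteDimensional K (M i)] : mult K a (∀ i, M i) = ∑ i, mult K a (M i) := by
  have : LinearMap.range (Algebra.lsmul K K (∀ i, M i) a) =
      Submodule.pi Set.univ fun i ↦ LinearMap.range (Algebra.lsmul K K (M i) a) := by
    ext x
    constructor
    · rintro ⟨y, rfl⟩ i _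
      exact ⟨y i, rfl⟩
    · intro h
      choose y hy using fun i ↦ h i trivial
      exact ⟨y, funext hy⟩
  rw [mult, this, (submodulePiEquiv _).finrank_eq, Module.finrank_pi_fintype]
  rfl

end Multiplicity

/-! ### Indecomposable projectives and their three layers. -/

/-- The indecomposable projective module `Λ e`. -/
abbrev proj {Λ : Type v} [Ring Λ] (e : Λ) : Submodule Λ Λ := Submodule.span Λ {e}

/-- The simple top of `Λ e`. -/
abbrev top {Λ : Type v} [Ring Λ] (e : Λ) : Type v := proj e ⧸ rad (⊤ : Submodule Λ (proj e))

/-- The idempotents `e i` are a complete set of basic primitive idempotents of a split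
self-injective algebra with radical cube zero whose indecomposable projective modules `Λ (e i)`
have simple socle isomorphic to their top, and whose quiver has adjacency matrix `E`. -/
structure IsBasicSystem (K : Type u) {Λ : Type v} [Field K] [Ring Λ] [Algebra K Λ]
    {ι : Type*} [DecidableEq ι] (e : ι → Λ) (E : Matrix ι ι ℕ) : Prop where
  jacobson_pow : Ring.jacobson Λ ^ 3 = ⊥
  idem : ∀ i, e i * e i = e i
  injective : Module.Injective Λ Λ
  exists_equiv : ∀ (T : Type v) [AddCommGroup T] [Module Λ T] [IsSimpleModule Λ T],
    ∃ i, Nonempty (T ≃ₗ[Λ] top (e i))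
  mult_top : ∀ i j, mult K (e j) (top (e i)) = if i = j then 1 else 0
  mult_rad : ∀ i j, mult K (e j) (rad (⊤ : Submodule Λ (proj (e i)))) =
    E i j + if i = j then 1 else 0
  socle_le : ∀ i, ∀ X : Submodule Λ (proj (e i)), rad X = ⊥ → X ≤ rad (rad ⊤)
  socle_equiv : ∀ i, Nonempty (top (e i) ≃ₗ[Λ] rad (rad (⊤ : Submodule Λ (proj (e i)))))

section General

variable {Λ : Type v} [Ring Λ] {M N : Type v} [AddCommGroup M] [Module Λ M] [AddCommGroup N]
  [Module Λ N]

theorem mem_proj_iff {e : Λ} (he : e * e = e) {x : Λ} : x ∈ proj e ↔ x * e = x := by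
  rw [Submodule.mem_span_singleton]
  constructor
  · rintro ⟨a, rfl⟩
    simp [mul_assoc, he]
  · intro h
    exact ⟨x, h⟩

/-- The projection of `Λ` onto `Λ e`. -/
def toProj (e : Λ) : Λ →ₗ[Λ] proj e :=
  (LinearMap.toSpanSingleton Λ Λ e).codRestrict _ fun x ↦
    Submodule.mem_span_singleton.mpr ⟨x, rfl⟩

theorem toProj_comp_subtype {e : Λ} (he : e * e = e) :
    (toProj e).comp (proj e).subtype = LinearMap.id := by
  ext x
  exact (mem_proj_iff he).mp x.2

theorem projective_proj {e : Λ} (he : e * e = e) : Module.Projective Λ (proj e) :=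
  Module.Projective.of_split _ _ (toProj_comp_subtype he)

theorem injective_of_retract (h : Module.Injective Λ N) (s : M →ₗ[Λ] N) (r : N →ₗ[Λ] M)
    (hr : r.comp s = LinearMap.id) : Module.Injective Λ M where
  out X Y _ _ _ _ f hf g := by
    obtain ⟨k, hk⟩ := h.out f hf (s.comp g)
    refine ⟨r.comp k, fun x ↦ ?_⟩
    rw [LinearMap.comp_apply, hk]
    exact LinearMap.congr_fun hr (g x)

theorem injective_pi {ι : Type*} {M : ι → Type v} [∀ i, AddCommGroup (M i)]
    [∀ i, Module Λ (M i)] (h : ∀ i, Module.Injective Λ (M i)) {X Y : Type v} [AddCommGroup X]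
    [AddCommGroup Y] [Module Λ X] [Module Λ Y] (f : X →ₗ[Λ] Y) (hf : Function.Injective f)
    (g : X →ₗ[Λ] ∀ i, M i) : ∃ k : Y →ₗ[Λ] ∀ i, M i, ∀ x, k (f x) = g x := by
  choose k hk using fun i ↦ (h i).out f hf ((LinearMap.proj i).comp g)
  exact ⟨LinearMap.pi k, fun x ↦ funext fun i ↦ hk i x⟩

theorem rad_top_eq_pi {ι : Type*} [Finite ι] {M : ι → Type*} [∀ i, AddCommGroup (M i)]
    [∀ i, Module Λ (M i)] :
    rad (⊤ : Submodule Λ (∀ i, M i)) = Submodule.pi Set.univ fun _ ↦ rad ⊤ := by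
  rw [← rad_pi, Submodule.pi_top]

theorem rad_rad_top_eq_pi {ι : Type*} [Finite ι] {M : ι → Type*} [∀ i, AddCommGroup (M i)]
    [∀ i, Module Λ (M i)] :
    rad (rad (⊤ : Submodule Λ (∀ i, M i))) = Submodule.pi Set.univ fun _ ↦ rad (rad ⊤) := by
  rw [rad_top_eq_pi, rad_pi]

/-- Projective modules with isomorphic tops are isomorphic. -/
theorem nonempty_equiv_of_top (K : Type u) [Field K] [Algebra K Λ] (hJ : Ring.jacobson Λ ^ 3 = ⊥)
    [Module K M] [IsScalarTower K Λ M] [Module K N] [IsScalarTower K Λ N]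
    [FiniteDimensional K M] [FiniteDimensional K N] [Module.Projective Λ M]
    [Module.Projective Λ N]
    (φ : (M ⧸ rad (⊤ : Submodule Λ M)) ≃ₗ[Λ] (N ⧸ rad (⊤ : Submodule Λ N))) :
    Nonempty (M ≃ₗ[Λ] N) := by
  have key : ∀ {M N : Type v} [AddCommGroup M] [Module Λ M] [AddCommGroup N] [Module Λ N]
      [Module.Projective Λ M]
      (_ : (M ⧸ rad (⊤ : Submodule Λ M)) ≃ₗ[Λ] (N ⧸ rad (⊤ : Submodule Λ N))),
      ∃ f : M →ₗ[Λ] N, Function.Surjective f := by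
    intro M N _ _ _ _ _ φ
    obtain ⟨f, hf⟩ := Module.projective_lifting_property (rad (⊤ : Submodule Λ N)).mkQ
      (φ.toLinearMap.comp (rad (⊤ : Submodule Λ M)).mkQ) (Submodule.mkQ_surjective _)
    refine ⟨f, surjective_of_range_sup_rad hJ ?_⟩
    have : (LinearMap.range f).map (rad (⊤ : Submodule Λ N)).mkQ = ⊤ := by
      rw [← LinearMap.range_comp, hf, LinearMap.range_eq_top]
      exact φ.surjective.comp (Submodule.mkQ_surjective _)
    rw [sup_comm, ← Submodule.comap_map_mkQ, this, Submodule.comap_top]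
  obtain ⟨f, hf⟩ := key φ
  obtain ⟨g, hg⟩ := key φ.symm
  have h1 := LinearMap.finrank_le_finrank_of_surjective (f := f.restrictScalars K) hf
  have h2 := LinearMap.finrank_le_finrank_of_surjective (f := g.restrictScalars K) hg
  have := (LinearMap.injective_iff_surjective_of_finrank_eq_finrank (le_antisymm h2 h1)
    (f := f.restrictScalars K)).mpr hf
  exact ⟨LinearEquiv.ofBijective f ⟨this, hf⟩⟩

/-- A finite-dimensional module annihilated by the radical is a product of simple modules. -/
theorem exists_equiv_pi_of_simple (K : Type u) [Field K] [Algebra K Λ] [FiniteDimensional K Λ]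
    {ι : Type*} {e : ι → Λ} (h : ∀ (T : Type v) [AddCommGroup T] [Module Λ T] [IsSimpleModule Λ T],
      ∃ i, Nonempty (T ≃ₗ[Λ] top (e i))) (Z : Type v) [AddCommGroup Z] [Module Λ Z]
    [Module K Z] [IsScalarTower K Λ Z] [FiniteDimensional K Z]
    (hZ : rad (⊤ : Submodule Λ Z) = ⊥) :
    ∃ (n : ℕ) (σ : Fin n → ι), Nonempty (Z ≃ₗ[Λ] ∀ k, top (e (σ k))) := by
  have : IsArtinianRing Λ := IsArtinianRing.of_finite K Λ
  have := isSemisimpleModule_of_rad hZ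
  have : Module.Finite Λ Z := Module.Finite.of_restrictScalars_finite K Λ Z
  obtain ⟨n, S, φ, hS⟩ := IsSemisimpleModule.exists_linearEquiv_fin_dfinsupp Λ Z
  choose σ hσ using fun k ↦ h (S k)
  exact ⟨n, σ, ⟨φ ≪≫ₗ DFinsupp.linearEquivFunOnFintype ≪≫ₗ
    LinearEquiv.piCongrRight fun k ↦ (hσ k).some⟩⟩

end General

section System

variable {K : Type u} {Λ : Type v} [Field K] [Ring Λ] [Algebra K Λ] [FiniteDimensional K Λ]
  {ι : Type*} [Fintype ι] [DecidableEq ι] {e : ι → Λ} {E : Matrix ι ι ℕ}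

namespace IsBasicSystem

theorem injective_proj (hs : IsBasicSystem K e E) (i : ι) : Module.Injective Λ (proj (e i)) :=
  injective_of_retract hs.injective _ _ (toProj_comp_subtype (hs.idem i))

theorem exists_equiv_pi_top (hs : IsBasicSystem K e E) (Z : Type v) [AddCommGroup Z] [Module Λ Z]
    [Module K Z] [IsScalarTower K Λ Z] [FiniteDimensional K Z]
    (hZ : rad (⊤ : Submodule Λ Z) = ⊥) :
    ∃ (n : ℕ) (σ : Fin n → ι), Nonempty (Z ≃ₗ[Λ] ∀ k, top (e (σ k))) :=
  exists_equiv_pi_of_simple K hs.exists_equiv Z hZ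

end IsBasicSystem

variable (e) in
/-- The product of the indecomposable projective modules `Λ (e (σ k))`. -/
abbrev projPi {n : ℕ} (σ : Fin n → ι) : Type v := ∀ k, proj (e (σ k))

namespace IsBasicSystem

variable {n : ℕ} (σ : Fin n → ι)

theorem extend_projPi (hs : IsBasicSystem K e E) {X Y : Type v} [AddCommGroup X] [AddCommGroup Y]
    [Module Λ X] [Module Λ Y] (f : X →ₗ[Λ] Y) (hf : Function.Injective f)
    (g : X →ₗ[Λ] projPi e σ) : ∃ k : Y →ₗ[Λ] projPi e σ, ∀ x, k (f x) = g x :=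
  injective_pi (fun _ ↦ hs.injective_proj _) f hf g

theorem projective_projPi (hs : IsBasicSystem K e E) : Module.Projective Λ (projPi e σ) := by
  have := fun k ↦ projective_proj (hs.idem (σ k))
  exact Module.Projective.of_equiv' (DFinsupp.linearEquivFunOnFintype (R := Λ)
    (M := fun k ↦ proj (e (σ k))))

theorem socle_le_projPi (hs : IsBasicSystem K e E) (X : Submodule Λ (projPi e σ))
    (hX : rad X = ⊥) : X ≤ rad (rad ⊤) := by
  rw [rad_rad_top_eq_pi]
  intro x hx k _
  refine hs.socle_le _ (X.map (LinearMap.proj k)) ?_ ⟨x, hx, rfl⟩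
  rw [← map_rad, hX, Submodule.map_bot]

theorem mult_socle (hs : IsBasicSystem K e E) (i j : ι) :
    mult K (e j) (rad (rad (⊤ : Submodule Λ (proj (e i))))) = if i = j then 1 else 0 := by
  rw [← hs.mult_top, mult_congr K _ (hs.socle_equiv i).some]

theorem mult_proj (hs : IsBasicSystem K e E) (i j : ι) :
    mult K (e j) (proj (e i)) = E i j + 2 * if i = j then 1 else 0 := by
  rw [← mult_submodule_add K (hs.idem j) (rad ⊤), hs.mult_top, hs.mult_rad]
  ring

theorem mult_socle_projPi (hs : IsBasicSystem K e E) (j : ι) :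
    mult K (e j) (rad (rad (⊤ : Submodule Λ (projPi e σ)))) =
      ∑ k, if σ k = j then 1 else 0 := by
  rw [mult_congr K _ (LinearEquiv.ofEq _ _ rad_rad_top_eq_pi), mult_congr K _ (submodulePiEquiv _),
    mult_pi]
  exact Finset.sum_congr rfl fun k _ ↦ hs.mult_socle _ _

/-- The multiplicities of the socle serve as the count of indecomposable summands, since each
summand has exactly one simple factor there. This form survives the passage to an arbitrary
projective module. -/
theorem mult_rad_projPi (hs : IsBasicSystem K e E) (j : ι) :
    mult K (e j) (rad (⊤ : Submodule Λ (projPi e σ))) =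
      ∑ i, mult K (e i) (rad (rad (⊤ : Submodule Λ (projPi e σ)))) * E i j +
        mult K (e j) (rad (rad (⊤ : Submodule Λ (projPi e σ)))) := by
  rw [mult_congr K _ (LinearEquiv.ofEq _ _ rad_top_eq_pi), mult_congr K _ (submodulePiEquiv _),
    mult_pi]
  simp_rw [hs.mult_socle_projPi, hs.mult_rad, Finset.sum_mul, Finset.sum_add_distrib]
  rw [Finset.sum_comm]
  simp

theorem mult_projPi (hs : IsBasicSystem K e E) (j : ι) :
    mult K (e j) (projPi e σ) = mult K (e j) (rad (⊤ : Submodule Λ (projPi e σ))) +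
        mult K (e j) (rad (rad (⊤ : Submodule Λ (projPi e σ)))) := by
  rw [mult_congr K (e j) (M := rad (⊤ : Submodule Λ (projPi e σ)))
    (LinearEquiv.ofEq _ _ rad_top_eq_pi ≪≫ₗ submodulePiEquiv _), mult_pi, mult_pi,
    hs.mult_socle_projPi,
    ← Finset.sum_add_distrib]
  refine Finset.sum_congr rfl fun k _ ↦ ?_
  rw [hs.mult_proj, hs.mult_rad]
  ring

theorem exists_equiv_projPi (hs : IsBasicSystem K e E) (P : Type v) [AddCommGroup P] [Module Λ P]
    [Module K P] [IsScalarTower K Λ P] [FiniteDimensional K P] [Module.Projective Λ P] :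
    ∃ (n : ℕ) (σ : Fin n → ι), Nonempty (P ≃ₗ[Λ] projPi e σ) := by
  obtain ⟨n, σ, ⟨φ⟩⟩ := hs.exists_equiv_pi_top (P ⧸ rad (⊤ : Submodule Λ P)) rad_top_quotient_rad
  have := hs.projective_projPi σ
  refine ⟨n, σ, nonempty_equiv_of_top K hs.jacobson_pow (φ ≪≫ₗ ?_)⟩
  let f : projPi e σ →ₗ[Λ] ∀ k, top (e (σ k)) :=
    LinearMap.pi fun k ↦ (Submodule.mkQ _).comp (LinearMap.proj k)
  have hf : Function.Surjective f := by
    intro x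
    choose y hy using fun k ↦ Submodule.mkQ_surjective _ (x k)
    exact ⟨y, funext hy⟩
  have hk : LinearMap.ker f = rad ⊤ := by
    rw [rad_top_eq_pi]
    ext x
    simp [f, funext_iff, Submodule.mem_pi]
  exact (f.quotKerEquivOfSurjective hf).symm ≪≫ₗ Submodule.quotEquivOfEq _ _ hk

/-- A finite-dimensional semisimple module is the socle of a projective module. -/
theorem exists_embedding (hs : IsBasicSystem K e E) (Z : Type v) [AddCommGroup Z] [Module Λ Z]
    [Module K Z] [IsScalarTower K Λ Z] [FiniteDimensional K Z]
    (hZ : rad (⊤ : Submodule Λ Z) = ⊥) :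
    ∃ (n : ℕ) (σ : Fin n → ι) (f : Z →ₗ[Λ] projPi e σ), Function.Injective f ∧
      LinearMap.range f = rad (rad ⊤) := by
  obtain ⟨n, σ, ⟨φ⟩⟩ := hs.exists_equiv_pi_top Z hZ
  let ψ : Z ≃ₗ[Λ] rad (rad (⊤ : Submodule Λ (projPi e σ))) :=
    φ ≪≫ₗ (LinearEquiv.piCongrRight fun k ↦ (hs.socle_equiv (σ k)).some) ≪≫ₗ
      (submodulePiEquiv _).symm ≪≫ₗ LinearEquiv.ofEq _ _ rad_rad_top_eq_pi.symm
  refine ⟨n, σ, (Submodule.subtype _).comp ψ.toLinearMap,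
    Subtype.val_injective.comp ψ.injective, ?_⟩
  rw [LinearMap.range_comp, LinearEquiv.range, Submodule.map_subtype_top]

/-- The restriction of `g` to `J²` splits by semisimplicity, and injectivity of the source extends
the section to `s` on the whole target. Then `g ∘ s` is the identity on the essential socle, so it
is an injective endomorphism of a finite-dimensional space, hence bijective. -/
theorem surjective_of_socle_le (hs : IsBasicSystem K e E) {m : ℕ} (τ : Fin m → ι)
    (g : projPi e τ →ₗ[Λ] projPi e σ)
    (hg : rad (rad ⊤) ≤ (rad (rad ⊤)).map g) : Function.Surjective g := by
  have : IsArtinianRing Λ := IsArtinianRing.of_finite K Λ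
  have := isSemisimpleModule_submodule (rad_rad_rad hs.jacobson_pow (⊤ : Submodule Λ (projPi e τ)))
  obtain ⟨h, hh⟩ := IsSemisimpleModule.lifting_property
    (g.restrict (p := rad (rad ⊤)) (q := rad (rad ⊤)) fun x hx ↦ by
      have : g x ∈ (rad (rad ⊤)).map g := ⟨x, hx, rfl⟩
      rw [map_rad, map_rad] at this
      exact rad_mono (rad_mono le_top) this) (by
      rintro ⟨y, hy⟩
      obtain ⟨x, hx, rfl⟩ := hg hy
      exact ⟨⟨x, hx⟩, rfl⟩) LinearMap.id
  obtain ⟨s, hs'⟩ := hs.extend_projPi τ (Submodule.subtype _) (Submodule.subtype_injective _)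
    ((Submodule.subtype _).comp h)
  have hid : ∀ x ∈ rad (rad (⊤ : Submodule Λ (projPi e σ))), g (s x) = x := by
    intro x hx
    have h1 := hs' ⟨x, hx⟩
    simp only [Submodule.subtype_apply] at h1
    rw [h1]
    exact congrArg Subtype.val (LinearMap.congr_fun hh ⟨x, hx⟩)
  have hinf : ∀ X : Submodule Λ (projPi e σ), X ≤ LinearMap.ker (g.comp s) →
      X ≤ rad (rad ⊤) → X = ⊥ := by
    intro X h1 h2
    rw [eq_bot_iff]
    intro x hx
    have := h1 hx
    rw [LinearMap.mem_ker, LinearMap.comp_apply, hid x (h2 hx)] at this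
    exact this
  -- Essentiality of the socle, climbed layer by layer: for `L` the kernel, `J² L`, then `J L`, then
  -- `L` lies in the socle, where `g ∘ s` is the identity.
  have hker : LinearMap.ker (g.comp s) = ⊥ := by
    have h2 := hinf (rad (rad (LinearMap.ker (g.comp s)))) ((rad_le _).trans (rad_le _))
      (rad_mono (rad_mono le_top))
    have h1 := hinf (rad (LinearMap.ker (g.comp s))) (rad_le _) (hs.socle_le_projPi σ _ h2)
    exact hinf _ le_rfl (hs.socle_le_projPi σ _ h1)
  have hsurj : Function.Surjective ((g.comp s).restrictScalars K) :=
    LinearMap.injective_iff_surjective.mp (LinearMap.ker_eq_bot (f := g.comp s).mp hker)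
  exact Function.Surjective.of_comp hsurj

end IsBasicSystem

end System

/-! ### Weighted length. -/

section Weight

variable (K : Type u) {Λ : Type v} [Field K] [Ring Λ] [Algebra K Λ]
  {ι : Type*} [Fintype ι] (e : ι → Λ) (δ : ι → ℕ)

/-- The length of `M`, where the simple module belonging to `e j` is counted with weight `δ j`. -/
noncomputable def weight (M : Type*) [AddCommGroup M] [Module Λ M] [Module K M]
    [IsScalarTower K Λ M] : ℕ :=
  ∑ j, δ j * mult K (e j) M

variable {M N : Type*} [AddCommGroup M] [Module Λ M] [Module K M] [IsScalarTower K Λ M]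
  [AddCommGroup N] [Module Λ N] [Module K N] [IsScalarTower K Λ N]

theorem weight_congr (φ : M ≃ₗ[Λ] N) : weight K e δ M = weight K e δ N :=
  Finset.sum_congr rfl fun j _ ↦ by rw [mult_congr K (e j) φ]

theorem weight_map_of_injective {f : M →ₗ[Λ] N} (hf : Function.Injective f)
    (X : Submodule Λ M) : weight K e δ (X.map f) = weight K e δ X :=
  Finset.sum_congr rfl fun j _ ↦ by rw [mult_map_of_injective K (e j) hf]

variable {e} (he : ∀ i, e i * e i = e i) [FiniteDimensional K M]
include he

theorem weight_submodule_add (X : Submodule Λ M) :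
    weight K e δ (M ⧸ X) + weight K e δ X = weight K e δ M := by
  simp only [weight, ← Finset.sum_add_distrib, ← mul_add, mult_submodule_add K (he _)]

theorem weight_map_mkQ_add {X Y : Submodule Λ M} (h : X ≤ Y) :
    weight K e δ (Y.map X.mkQ) + weight K e δ X = weight K e δ Y := by
  simp only [weight, ← Finset.sum_add_distrib, ← mul_add]
  refine Finset.sum_congr rfl fun j _ ↦ ?_
  rw [← mult_map_add_ker K (he j) ((Submodule.ker_mkQ X).trans_le h)]
  congr 2
  exact (mult_congr K _ (LinearEquiv.ofEq _ _ (Submodule.ker_mkQ X))).symm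

theorem weight_range_le (f : M →ₗ[Λ] N) : weight K e δ (LinearMap.range f) ≤ weight K e δ M :=
  Finset.sum_le_sum fun j _ ↦ Nat.mul_le_mul le_rfl ((mult_ker_add K (he j) f).le.trans'
    (Nat.le_add_right _ _))

end Weight

/-! ### Syzygies of top-heavy modules. -/

section Preinjective

variable {K : Type u} {Λ : Type v} [Field K] [Ring Λ] [Algebra K Λ] [FiniteDimensional K Λ]
  {ι : Type*} [Fintype ι] [DecidableEq ι] {e : ι → Λ} {E : Matrix ι ι ℕ} {δ : ι → ℕ}

/-- The condition `J² M = 0` and every quotient of `M` has at least as much weight in its top as in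
its radical; it is shared by the preinjective modules over the separated quiver. -/
structure IsTopHeavy (K : Type u) {Λ : Type v} [Field K] [Ring Λ] [Algebra K Λ]
    {ι : Type*} [Fintype ι] (e : ι → Λ) (δ : ι → ℕ) (M : Type v)
    [AddCommGroup M] [Module Λ M] [Module K M] [IsScalarTower K Λ M] : Prop where
  rad_rad : rad (rad (⊤ : Submodule Λ M)) = ⊥
  le_weight (X : Submodule Λ M) :
    2 * weight K e δ (rad (⊤ : Submodule Λ (M ⧸ X))) ≤ weight K e δ (M ⧸ X)

theorem IsTopHeavy.le_weight_of_surjective {M Y : Type v} [AddCommGroup M] [Module Λ M]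
    [Module K M] [IsScalarTower K Λ M] [AddCommGroup Y] [Module Λ Y]
    [Module K Y] [IsScalarTower K Λ Y] (hM : IsTopHeavy K e δ M)
    {f : M →ₗ[Λ] Y} (hf : Function.Surjective f) :
    2 * weight K e δ (rad (⊤ : Submodule Λ Y)) ≤ weight K e δ Y := by
  have h := hM.le_weight (LinearMap.ker f)
  let φ := f.quotKerEquivOfSurjective hf
  rw [weight_congr K e δ φ, ← weight_map_of_injective K e δ (f := φ.toLinearMap) φ.injective,
    weight_congr K e δ (LinearEquiv.ofEq _ _ (map_rad_top_of_surjective φ.surjective))] at h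
  exact h

theorem exists_surjective_of_ker_le {P M Y : Type*} [AddCommGroup M] [Module Λ M]
    [AddCommGroup Y] [Module Λ Y] [AddCommGroup P] [Module Λ P] {f : P →ₗ[Λ] M}
    (hf : Function.Surjective f) {g : P →ₗ[Λ] Y} (hg : Function.Surjective g)
    (h : LinearMap.ker f ≤ LinearMap.ker g) : ∃ k : M →ₗ[Λ] Y, Function.Surjective k := by
  refine ⟨((LinearMap.ker f).liftQ g h).comp (f.quotKerEquivOfSurjective hf).symm.toLinearMap,
    ?_⟩
  have : Function.Surjective ((LinearMap.ker f).liftQ g h) := by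
    rw [← LinearMap.range_eq_top, Submodule.range_liftQ, LinearMap.range_eq_top.mpr hg]
  exact this.comp (f.quotKerEquivOfSurjective hf).symm.surjective

namespace IsBasicSystem

variable {n : ℕ} (σ : Fin n → ι)

/-- By `E δ = 2 δ` the middle layer weighs twice the socle, so the layers of a projective weigh 1 :
2 : 1. -/
theorem weight_rad_projPi (hs : IsBasicSystem K e E) (hδ : ∀ i, ∑ j, E i j * δ j = 2 * δ i) :
    weight K e δ (rad (⊤ : Submodule Λ (projPi e σ))) =
      3 * weight K e δ (rad (rad (⊤ : Submodule Λ (projPi e σ)))) := by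
  have h : weight K e δ (rad (⊤ : Submodule Λ (projPi e σ))) =
      ∑ i, mult K (e i) (rad (rad (⊤ : Submodule Λ (projPi e σ)))) * ∑ j, E i j * δ j +
        weight K e δ (rad (rad (⊤ : Submodule Λ (projPi e σ)))) := by
    simp only [weight, hs.mult_rad_projPi, mul_add, Finset.sum_add_distrib, Finset.mul_sum]
    rw [Finset.sum_comm]
    congr 1
    exact Finset.sum_congr rfl fun _ _ ↦ Finset.sum_congr rfl fun _ _ ↦ by ring
  rw [h]
  simp only [hδ, weight, Finset.mul_sum, ← Finset.sum_add_distrib]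
  exact Finset.sum_congr rfl fun _ _ ↦ by ring

theorem weight_projPi (hs : IsBasicSystem K e E) (hδ : ∀ i, ∑ j, E i j * δ j = 2 * δ i) :
    weight K e δ (projPi e σ) =
      4 * weight K e δ (rad (rad (⊤ : Submodule Λ (projPi e σ)))) := by
  have h : weight K e δ (projPi e σ) = weight K e δ (rad (⊤ : Submodule Λ (projPi e σ))) +
      weight K e δ (rad (rad (⊤ : Submodule Λ (projPi e σ)))) := by
    simp only [weight, hs.mult_projPi, mul_add, Finset.sum_add_distrib]
  rw [h, hs.weight_rad_projPi σ hδ]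
  ring

theorem weight_pos (hs : IsBasicSystem K e E) (hpos : ∀ i, 0 < δ i) (Z : Type v) [AddCommGroup Z]
    [Module Λ Z] [Module K Z] [IsScalarTower K Λ Z] [FiniteDimensional K Z] [Nontrivial Z]
    (hZ : rad (⊤ : Submodule Λ Z) = ⊥) : 0 < weight K e δ Z := by
  obtain ⟨n, σ, ⟨φ⟩⟩ := hs.exists_equiv_pi_top Z hZ
  obtain ⟨z, hz⟩ := exists_ne (0 : Z)
  have : ∃ k : Fin n, φ z k ≠ 0 := by
    by_contra! h
    exact hz (φ.injective (by rw [map_zero]; exact funext h))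
  obtain ⟨k, -⟩ := this
  rw [weight_congr K e δ φ]
  refine (Nat.mul_pos (hpos (σ k)) ?_).trans_le (Finset.single_le_sum
    (f := fun j ↦ δ j * mult K (e j) (∀ k, top (e (σ k)))) (fun _ _ ↦ Nat.zero_le _)
      (Finset.mem_univ (σ k)))
  rw [mult_pi]
  refine Nat.lt_of_lt_of_le ?_ (Finset.single_le_sum
    (f := fun l ↦ mult K (e (σ k)) (top (e (σ l)))) (fun _ _ ↦ Nat.zero_le _) (Finset.mem_univ k))
  simp [hs.mult_top]

section Syzygy

variable {P M : Type v} [AddCommGroup P] [Module Λ P] [Module K P] [IsScalarTower K Λ P]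
  [FiniteDimensional K P] [Module.Projective Λ P]
  [AddCommGroup M] [Module Λ M] [Module K M] [IsScalarTower K Λ M]
  {f : P →ₗ[Λ] M}

theorem surjective_of_socle_le_map (hs : IsBasicSystem K e E) (g : P →ₗ[Λ] projPi e σ)
    (hg : rad (rad ⊤) ≤ (rad (rad ⊤)).map g) : Function.Surjective g := by
  obtain ⟨m, τ, ⟨φ⟩⟩ := hs.exists_equiv_projPi P
  have : Function.Surjective (g.comp φ.symm.toLinearMap) := by
    apply hs.surjective_of_socle_le
    rwa [Submodule.map_comp, map_rad φ.symm.toLinearMap,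
      map_rad_top_of_surjective φ.symm.surjective]
  exact Function.Surjective.of_comp this

variable [FiniteDimensional K M]

/-- Write `Ω` for the kernel. If `J² P` is not inside `J Ω`, its image `Z` in the top of `Ω` is a
nonzero direct summand. Embed `Z` as the socle of a projective-injective `I` and extend `Ω → Z → I`
to `g : P → I`. It covers the socle, hence is surjective, and sends `Ω` into the socle, so `M` maps
onto `I / soc I`. With `w` the weight of `Z`, that quotient weighs `3 w` and its radical `2 w`,
contradicting top-heaviness. -/
theorem rad_ker_eq (hs : IsBasicSystem K e E) (hδ : ∀ i, ∑ j, E i j * δ j = 2 * δ i)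
    (hpos : ∀ i, 0 < δ i) (hf : Function.Surjective f) (hker : LinearMap.ker f ≤ rad ⊤)
    (hM : IsTopHeavy K e δ M) : rad (LinearMap.ker f) = rad (rad ⊤) := by
  have hB : rad (rad ⊤) ≤ LinearMap.ker f := by
    rw [LinearMap.le_ker_iff_map, map_rad, map_rad_top_of_surjective hf, hM.rad_rad]
  refine le_antisymm (rad_mono hker) ?_
  have : IsArtinianRing Λ := IsArtinianRing.of_finite K Λ
  let q := (rad (⊤ : Submodule Λ (LinearMap.ker f))).mkQ
  have : IsSemisimpleModule Λ (LinearMap.ker f ⧸ rad (⊤ : Submodule Λ (LinearMap.ker f))) :=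
    isSemisimpleModule_top_quotient
  let Z := ((rad (rad ⊤)).comap (LinearMap.ker f).subtype).map q
  obtain ⟨h, hh⟩ := IsSemisimpleModule.extension_property Z.subtype Z.subtype_injective
    LinearMap.id
  by_cases hZ : Z = ⊥
  · rw [show Z = Submodule.map q _ from rfl, ← LinearMap.le_ker_iff_map, Submodule.ker_mkQ] at hZ
    have := Submodule.map_mono (f := (LinearMap.ker f).subtype) hZ
    rwa [map_subtype_rad_top, Submodule.map_comap_subtype, inf_eq_right.mpr hB] at this
  · exfalso
    have : Nontrivial Z := Submodule.nontrivial_iff_ne_bot.mpr hZ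
    have hZrad : rad (⊤ : Submodule Λ Z) = ⊥ := rad_top_of_isSemisimpleModule
    have hZpos := hs.weight_pos hpos Z hZrad
    obtain ⟨n, σ, ψ, hψ, hψr⟩ := hs.exists_embedding Z hZrad
    obtain ⟨g, hg⟩ := hs.extend_projPi σ (LinearMap.ker f).subtype (Submodule.subtype_injective _)
      (ψ.comp (h.comp q))
    have hgsurj : Function.Surjective g := by
      refine hs.surjective_of_socle_le_map σ g ?_
      rw [← hψr]
      rintro _ ⟨⟨_, b, hb, rfl⟩, rfl⟩
      refine ⟨b, hb, (hg b).trans ?_⟩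
      exact congrArg ψ (LinearMap.congr_fun hh ⟨q b, b, hb, rfl⟩)
    obtain ⟨k, hk⟩ := exists_surjective_of_ker_le hf
      (g := (rad (rad (⊤ : Submodule Λ (projPi e σ)))).mkQ.comp g)
      ((Submodule.mkQ_surjective _).comp hgsurj) (by
        intro x hx
        rw [LinearMap.mem_ker, LinearMap.comp_apply, Submodule.mkQ_apply,
          Submodule.Quotient.mk_eq_zero, ← hψr]
        exact ⟨_, (hg ⟨x, hx⟩).symm⟩)
    have h1 := hM.le_weight_of_surjective hk
    have h2 := weight_submodule_add K δ hs.idem (rad (rad (⊤ : Submodule Λ (projPi e σ))))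
    have h3 := weight_map_mkQ_add K δ hs.idem (rad_le (rad (⊤ : Submodule Λ (projPi e σ))))
    rw [weight_congr K e δ (LinearEquiv.ofEq _ _ (map_rad_top_of_surjective
      (Submodule.mkQ_surjective _))), hs.weight_rad_projPi σ hδ] at h3
    rw [hs.weight_projPi σ hδ] at h2
    have h4 := weight_congr K e δ (LinearEquiv.ofInjective ψ hψ ≪≫ₗ LinearEquiv.ofEq _ _ hψr)
    omega

/-- For a quotient `Y` of the kernel, embed `rad Y` as the socle of a projective-injective `I` and
extend to `φ : Y → I` and `g : P → I`. By `rad_ker_eq`, `g` maps `J² P` onto the socle, so `g` is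
surjective and `M` maps onto `I / φ(Y)`. With `w` the weight of `rad Y` and `r` that of `φ(Y) ≤ rad
I`, top-heaviness of `M` reads `2 (3 w - r) ≤ 4 w - r`, that is `2 w ≤ r`, and `r` is at most the
weight of `Y`. -/
theorem isTopHeavy_ker (hs : IsBasicSystem K e E) (hδ : ∀ i, ∑ j, E i j * δ j = 2 * δ i)
    (hpos : ∀ i, 0 < δ i) (hf : Function.Surjective f) (hker : LinearMap.ker f ≤ rad ⊤)
    (hM : IsTopHeavy K e δ M) : IsTopHeavy K e δ (LinearMap.ker f) := by
  have hrad : rad (rad (⊤ : Submodule Λ (LinearMap.ker f))) = ⊥ := by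
    apply Submodule.map_injective_of_injective (Submodule.injective_subtype _)
    rw [map_rad, map_subtype_rad_top, Submodule.map_bot, eq_bot_iff,
      ← rad_rad_rad hs.jacobson_pow ⊤]
    exact rad_mono (rad_mono hker)
  refine ⟨hrad, fun X ↦ ?_⟩
  have hZ : rad (⊤ : Submodule Λ (rad (⊤ : Submodule Λ (LinearMap.ker f ⧸ X)))) = ⊥ := by
    apply Submodule.map_injective_of_injective (Submodule.injective_subtype _)
    rw [map_subtype_rad_top, Submodule.map_bot,
      ← map_rad_top_of_surjective (Submodule.mkQ_surjective X), ← map_rad, hrad, Submodule.map_bot]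
  obtain ⟨n, σ, ψ, hψ, hψr⟩ := hs.exists_embedding _ hZ
  obtain ⟨φ, hφ⟩ := hs.extend_projPi σ _ (Submodule.subtype_injective _) ψ
  obtain ⟨g, hg⟩ := hs.extend_projPi σ (LinearMap.ker f).subtype (Submodule.subtype_injective _)
    (φ.comp X.mkQ)
  have hg' : g.comp (LinearMap.ker f).subtype = φ.comp X.mkQ := LinearMap.ext hg
  have hφ' : φ.comp (Submodule.subtype _) = ψ := LinearMap.ext hφ
  have hgsurj : Function.Surjective g := by
    refine hs.surjective_of_socle_le_map σ g ?_
    rw [← hs.rad_ker_eq hδ hpos hf hker hM, ← map_subtype_rad_top (LinearMap.ker f),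
      ← Submodule.map_comp, hg',
      Submodule.map_comp, map_rad_top_of_surjective (Submodule.mkQ_surjective X), ← hψr, ← hφ',
      LinearMap.range_comp, Submodule.range_subtype]
  obtain ⟨k, hk⟩ := exists_surjective_of_ker_le hf
    (g := (LinearMap.range φ).mkQ.comp g)
    ((Submodule.mkQ_surjective _).comp hgsurj) (by
      intro x hx
      rw [LinearMap.mem_ker, LinearMap.comp_apply, Submodule.mkQ_apply,
        Submodule.Quotient.mk_eq_zero]
      exact ⟨_, (hg ⟨x, hx⟩).symm⟩)
  have hrange : LinearMap.range φ ≤ rad ⊤ := by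
    have : LinearMap.range φ = (LinearMap.ker f).map g := by
      conv_rhs => rw [← Submodule.map_subtype_top (LinearMap.ker f), ← Submodule.map_comp, hg',
        Submodule.map_comp, Submodule.map_top, Submodule.range_mkQ, Submodule.map_top]
    rw [this]
    exact (Submodule.map_mono hker).trans (map_rad_top_le g)
  have h1 := hM.le_weight_of_surjective hk
  have h2 := weight_submodule_add K δ hs.idem (LinearMap.range φ)
  have h3 := weight_map_mkQ_add K δ hs.idem hrange
  rw [weight_congr K e δ (LinearEquiv.ofEq _ _ (map_rad_top_of_surjective
    (Submodule.mkQ_surjective _))), hs.weight_rad_projPi σ hδ] at h3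
  rw [hs.weight_projPi σ hδ] at h2
  have h4 := weight_congr K e δ (LinearEquiv.ofInjective ψ hψ ≪≫ₗ LinearEquiv.ofEq _ _ hψr)
  have h5 := weight_range_le K δ hs.idem φ
  omega

end Syzygy

end IsBasicSystem

end Preinjective

/-! ### Projective modules with prescribed multiplicities. -/

section Standard

variable {Λ : Type v} [Ring Λ] {ι : Type*} [Fintype ι] [DecidableEq ι]

/-- The projective module with `v j` summands `Λ (e j)` for every `j`. -/
abbrev stdProj (e : ι → Λ) (v : ι → ℕ) : Type _ := ∀ x : (Σ j, Fin (v j)), proj (e x.1)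

theorem nonempty_equiv_stdProj (e : ι → Λ) {α : Type*} [Fintype α] (σ : α → ι) (v : ι → ℕ)
    (h : ∀ j, v j = ∑ k, if σ k = j then 1 else 0) :
    Nonempty ((∀ k, proj (e (σ k))) ≃ₗ[Λ] stdProj e v) := by
  have hc : ∀ j, Nonempty (Fin (v j) ≃ {k // σ k = j}) := fun j ↦ by
    rw [← Fintype.card_eq, Fintype.card_fin, Fintype.card_subtype, Finset.card_filter, h]
  let s : (Σ j, Fin (v j)) ≃ α :=
    (Equiv.sigmaCongrRight fun j ↦ (hc j).some).trans (Equiv.sigmaFiberEquiv σ)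
  have hs : ∀ x, σ (s x) = x.1 := fun x ↦ ((hc x.1).some x.2).2
  exact ⟨(LinearEquiv.piCongrLeft Λ (fun k ↦ proj (e (σ k))) s).symm ≪≫ₗ
    LinearEquiv.piCongrRight fun x ↦ LinearEquiv.ofEq _ _ (by rw [hs])⟩

theorem sum_sigma_fin_ite (v : ι → ℕ) (j : ι) :
    v j = ∑ x : (Σ j, Fin (v j)), if x.1 = j then 1 else 0 := by
  rw [Fintype.sum_sigma, Finset.sum_eq_single j]
  · rw [Finset.sum_congr rfl fun y _ ↦ if_pos rfl]
    simp
  · exact fun i _ h ↦ Finset.sum_eq_zero fun y _ ↦ if_neg h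
  · exact fun h ↦ absurd (Finset.mem_univ j) h

theorem nonempty_prod_stdProj (e : ι → Λ) (v w : ι → ℕ) :
    Nonempty ((stdProj e v × stdProj e w) ≃ₗ[Λ] stdProj e (v + w)) := by
  obtain ⟨φ⟩ := nonempty_equiv_stdProj e (α := (Σ j, Fin (v j)) ⊕ (Σ j, Fin (w j)))
    (Sum.elim Sigma.fst Sigma.fst) (v + w) fun j ↦ by
      rw [Pi.add_apply, Fintype.sum_sum_type]
      exact congrArg₂ _ (sum_sigma_fin_ite v j) (sum_sigma_fin_ite w j)
  exact ⟨(LinearEquiv.sumPiEquivProdPi Λ _ _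
    (fun k ↦ proj (e (Sum.elim Sigma.fst Sigma.fst k)))).symm ≪≫ₗ φ⟩

theorem nonempty_pi_stdProj (e : ι → Λ) {n : ℕ} (v : Fin n → ι → ℕ) :
    Nonempty ((∀ k, stdProj e (v k)) ≃ₗ[Λ] stdProj e (∑ k, v k)) := by
  obtain ⟨φ⟩ := nonempty_equiv_stdProj e (α := Σ k : Fin n, Σ j, Fin (v k j))
    (fun x ↦ x.2.1) (∑ k, v k) fun j ↦ by
      rw [Finset.sum_apply, Fintype.sum_sigma]
      exact Finset.sum_congr rfl fun k _ ↦ sum_sigma_fin_ite (v k) j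
  exact ⟨(LinearEquiv.piCurry Λ fun k (x : Σ j, Fin (v k j)) ↦ proj (e x.1)).symm ≪≫ₗ φ⟩

end Standard

/-! ### The recurrence along a minimal resolution. -/

section Resolution

variable {K : Type u} {Λ : Type v} [Field K] [Ring Λ] [Algebra K Λ] [FiniteDimensional K Λ]
  {ι : Type*} [Fintype ι] [DecidableEq ι] {e : ι → Λ} {E : Matrix ι ι ℕ} {δ : ι → ℕ}

/-- The terms of a resolution are not assumed finitely generated. A finite free cover of `M` lifts
to `P` and is onto modulo `rad P`, hence onto. -/
theorem finiteDimensional_of_ker_le (hJ : Ring.jacobson Λ ^ 3 = ⊥)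
    {P M : Type*} [AddCommGroup P] [Module Λ P] [Module K P] [IsScalarTower K Λ P]
    [AddCommGroup M] [Module Λ M] [Module K M] [IsScalarTower K Λ M] [FiniteDimensional K M]
    {f : P →ₗ[Λ] M} (hf : Function.Surjective f) (hker : LinearMap.ker f ≤ rad ⊤) :
    FiniteDimensional K P := by
  have : Module.Finite Λ M := Module.Finite.of_restrictScalars_finite K Λ M
  obtain ⟨n, g, hg⟩ := Module.Finite.exists_fin' Λ M
  obtain ⟨h, hh⟩ := Module.projective_lifting_property f g hf
  have hsurj : Function.Surjective h := by
    refine surjective_of_range_sup_rad hJ (top_le_iff.mp ?_)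
    refine le_trans ?_ (sup_le_sup_left hker _)
    rw [← Submodule.comap_map_eq, ← LinearMap.range_comp, hh, LinearMap.range_eq_top.mpr hg,
      Submodule.comap_top]
  exact Module.Finite.of_surjective (h.restrictScalars K) hsurj

theorem isTopHeavy_of_isSimpleModule {S : Type v} [AddCommGroup S] [Module Λ S] [Module K S]
    [IsScalarTower K Λ S] [IsSimpleModule Λ S] : IsTopHeavy K e δ S where
  rad_rad := by rw [eq_bot_iff, ← rad_top_of_isSemisimpleModule (Λ := Λ)]; exact rad_le _
  le_weight X := by
    have (a : Λ) : mult K a (rad (⊤ : Submodule Λ (S ⧸ X))) = 0 := by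
      rw [mult_congr K a (LinearEquiv.ofEq _ _ rad_top_of_isSemisimpleModule), mult_bot]
    simp [weight, this]

namespace IsBasicSystem

section Projective

variable {P M : Type v} [AddCommGroup P] [Module Λ P] [Module K P] [IsScalarTower K Λ P]
  [FiniteDimensional K P] [Module.Projective Λ P]
  [AddCommGroup M] [Module Λ M] [Module K M] [IsScalarTower K Λ M]
  {f : P →ₗ[Λ] M}

theorem mult_rad_rad_congr {Q : Type*} [AddCommGroup Q] [Module Λ Q] [Module K Q]
    [IsScalarTower K Λ Q] (φ : P ≃ₗ[Λ] Q) (a : Λ) :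
    mult K a (rad (rad (⊤ : Submodule Λ P))) = mult K a (rad (rad (⊤ : Submodule Λ Q))) := by
  rw [← mult_map_of_injective K a (f := φ.toLinearMap) φ.injective]
  refine mult_congr K a (LinearEquiv.ofEq _ _ ?_)
  rw [map_rad, map_rad_top_of_surjective φ.surjective]

theorem mult_rad_congr {Q : Type*} [AddCommGroup Q] [Module Λ Q] [Module K Q]
    [IsScalarTower K Λ Q] (φ : P ≃ₗ[Λ] Q) (a : Λ) :
    mult K a (rad (⊤ : Submodule Λ P)) = mult K a (rad (⊤ : Submodule Λ Q)) := by
  rw [← mult_map_of_injective K a (f := φ.toLinearMap) φ.injective]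
  refine mult_congr K a (LinearEquiv.ofEq _ _ ?_)
  rw [map_rad_top_of_surjective φ.surjective]

theorem mult_rad_projective (hs : IsBasicSystem K e E) (j : ι) :
    mult K (e j) (rad (⊤ : Submodule Λ P)) =
      ∑ i, mult K (e i) (rad (rad (⊤ : Submodule Λ P))) * E i j +
        mult K (e j) (rad (rad (⊤ : Submodule Λ P))) := by
  obtain ⟨n, σ, ⟨φ⟩⟩ := hs.exists_equiv_projPi P
  simp_rw [mult_rad_congr φ, mult_rad_rad_congr φ]
  exact hs.mult_rad_projPi σ j

theorem mult_projective (hs : IsBasicSystem K e E) (j : ι) :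
    mult K (e j) P = mult K (e j) (rad (⊤ : Submodule Λ P)) +
        mult K (e j) (rad (rad (⊤ : Submodule Λ P))) := by
  obtain ⟨n, σ, ⟨φ⟩⟩ := hs.exists_equiv_projPi P
  rw [mult_rad_congr φ, mult_rad_rad_congr φ, mult_congr K (e j) φ]
  exact hs.mult_projPi σ j

/-- A kernel inside the radical means that `M` and `P` have the same top, and the top of `P` has the
multiplicities of its socle `J² P`. -/
theorem mult_eq_of_surjective (hs : IsBasicSystem K e E) (hf : Function.Surjective f)
    (hker : LinearMap.ker f ≤ rad ⊤) (j : ι) :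
    mult K (e j) M = mult K (e j) (rad (rad (⊤ : Submodule Λ P))) +
      mult K (e j) (rad (⊤ : Submodule Λ M)) := by
  have h1 := mult_map_add_ker K (hs.idem j) hker
  rw [mult_congr K (e j) (LinearEquiv.ofEq _ _ (map_rad_top_of_surjective hf))] at h1
  have h2 := mult_ker_add K (hs.idem j) f
  rw [mult_congr K (e j) (LinearEquiv.ofTop _ (LinearMap.range_eq_top.mpr hf))] at h2
  have h3 := hs.mult_projective (P := P) j
  omega

theorem nonempty_equiv_stdProj (hs : IsBasicSystem K e E) :
    Nonempty (P ≃ₗ[Λ] stdProj e fun j ↦ mult K (e j) (rad (rad (⊤ : Submodule Λ P)))) := by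
  obtain ⟨n, σ, ⟨φ⟩⟩ := hs.exists_equiv_projPi P
  obtain ⟨ψ⟩ := RadicalCube.nonempty_equiv_stdProj e σ
    (fun j ↦ mult K (e j) (rad (rad (⊤ : Submodule Λ P)))) fun j ↦ by
      rw [mult_rad_rad_congr φ, hs.mult_socle_projPi]
  exact ⟨φ ≪≫ₗ ψ⟩

end Projective

variable {S : Type v} [AddCommGroup S] [Module Λ S] [Module K S] [IsScalarTower K Λ S]
  [IsSimpleModule Λ S] {P : ℕ → Type v} [∀ n, AddCommGroup (P n)] [∀ n, Module Λ (P n)]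
  [∀ n, Module K (P n)] [∀ n, IsScalarTower K Λ (P n)] [∀ n, Module.Projective Λ (P n)]

/-- The multiplicities of the indecomposable projective modules in a minimal projective resolution
of a simple module satisfy a linear recurrence of Chebyshev type. -/
theorem exists_recurrence (hs : IsBasicSystem K e E) (hδ : ∀ i, ∑ j, E i j * δ j = 2 * δ i)
    (hpos : ∀ i, 0 < δ i) (ε : P 0 →ₗ[Λ] S) (d : ∀ n, P (n + 1) →ₗ[Λ] P n)
    (hε : Function.Surjective ε) (h0 : LinearMap.range (d 0) = LinearMap.ker ε)
    (hd : ∀ n, LinearMap.range (d (n + 1)) = LinearMap.ker (d n))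
    (hmin : ∀ n, LinearMap.range (d n) ≤ rad ⊤) :
    ∃ (i : ι) (t : ℕ → ι → ℕ), t 0 = Pi.single i 1 ∧ t 1 = Matrix.vecMul (t 0) E ∧
      (∀ n, t (n + 2) + t n = Matrix.vecMul (t (n + 1)) E) ∧
      ∀ n, Nonempty (P n ≃ₗ[Λ] stdProj e (t n)) := by
  have hS : FiniteDimensional K S := by
    have : Module.Finite K (top (e (hs.exists_equiv S).choose)) := inferInstance
    exact Module.Finite.equiv ((hs.exists_equiv S).choose_spec.some.symm.restrictScalars K)
  have hfin0 : FiniteDimensional K (P 0) :=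
    finiteDimensional_of_ker_le hs.jacobson_pow hε (h0 ▸ hmin 0)
  let f : ∀ n, P (n + 1) →ₗ[Λ] LinearMap.range (d n) := fun n ↦ (d n).rangeRestrict
  have hf : ∀ n, Function.Surjective (f n) := fun n ↦ LinearMap.surjective_rangeRestrict _
  have hfk : ∀ n, LinearMap.range (d (n + 1)) = LinearMap.ker (f n) := fun n ↦ by
    rw [hd, LinearMap.ker_rangeRestrict]
  have hfr : ∀ n, LinearMap.ker (f n) ≤ rad ⊤ := fun n ↦ hfk n ▸ hmin (n + 1)
  -- Each syzygy is top-heavy because the previous one is; the last component is what the count of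
  -- composition factors needs.
  have main : ∀ n, FiniteDimensional K (P n) ∧ IsTopHeavy K e δ (LinearMap.range (d n)) ∧
      rad (LinearMap.range (d n)) = rad (rad ⊤) := by
    intro n
    induction n with
    | zero =>
      rw [h0]
      exact ⟨hfin0, hs.isTopHeavy_ker hδ hpos hε (h0 ▸ hmin 0) isTopHeavy_of_isSimpleModule,
        hs.rad_ker_eq hδ hpos hε (h0 ▸ hmin 0) isTopHeavy_of_isSimpleModule⟩
    | succ n ih =>
      obtain ⟨h1, h2, -⟩ := ih
      have := finiteDimensional_of_ker_le (K := K) hs.jacobson_pow (hf n) (hfr n)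
      rw [hfk]
      exact ⟨this, hs.isTopHeavy_ker hδ hpos (hf n) (hfr n) h2,
        hs.rad_ker_eq hδ hpos (hf n) (hfr n) h2⟩
  have hfin := fun n ↦ (main n).1
  let t : ℕ → ι → ℕ := fun n j ↦ mult K (e j) (rad (rad (⊤ : Submodule Λ (P n))))
  have ht : ∀ n j, mult K (e j) (P n) = Matrix.vecMul (t n) E j + 2 * t n j := by
    intro n j
    rw [hs.mult_projective, hs.mult_rad_projective, add_assoc, ← two_mul]
    rfl
  -- The top of the syzygy is the top of `P (n + 1)`, and its radical is `J² (P n)`.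
  have hrange : ∀ n j, mult K (e j) (LinearMap.range (d n)) = t (n + 1) j + t n j := by
    intro n j
    rw [hs.mult_eq_of_surjective (hf n) (hfr n)]
    congr 1
    rw [← mult_map_of_injective K (e j) (LinearMap.range (d n)).subtype_injective]
    exact mult_congr K (e j) (LinearEquiv.ofEq _ _ ((map_subtype_rad_top _).trans (main n).2.2))
  have hS0 : ∀ j, mult K (e j) S = t 0 j := by
    intro j
    rw [hs.mult_eq_of_surjective hε (h0 ▸ hmin 0),
      mult_congr K (e j) (LinearEquiv.ofEq _ _ rad_top_of_isSemisimpleModule), mult_bot, add_zero]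
  obtain ⟨i, ⟨φ⟩⟩ := hs.exists_equiv S
  refine ⟨i, t, ?_, ?_, ?_, fun n ↦ hs.nonempty_equiv_stdProj⟩
  · funext j
    rw [← hS0, mult_congr K (e j) φ, hs.mult_top, Pi.single_apply]
    simp only [eq_comm]
  · funext j
    have := mult_ker_add K (hs.idem j) ε
    rw [mult_congr K (e j) (LinearEquiv.ofTop _ (LinearMap.range_eq_top.mpr hε)),
      mult_congr K (e j) (LinearEquiv.ofEq _ _ h0.symm), hrange, ht, hS0,
      zero_add] at this
    omega
  · intro n
    funext j
    have := mult_ker_add K (hs.idem j) (d n)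
    rw [mult_congr K (e j) (LinearEquiv.ofEq _ _ (hd n).symm), hrange, hrange, ht] at this
    rw [Pi.add_apply, ← one_add_one_eq_two, ← add_assoc]
    omega

end IsBasicSystem

end Resolution

open Polynomial

/-! ### Chebyshev polynomials evaluated at a ring element. -/

section Chebyshev

variable {A : Type*} [Ring A] (a : A)

/-- The value at `a` of the `n`-th rescaled Chebyshev polynomial of the first kind. -/
noncomputable def chebC (n : ℤ) : A := aeval a (Chebyshev.C ℤ n)

/-- The value at `a` of the `n`-th rescaled Chebyshev polynomial of the second kind. -/
noncomputable def chebS (n : ℤ) : A := aeval a (Chebyshev.S ℤ n)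

theorem chebC_zero : chebC a 0 = 2 := by
  rw [chebC, Chebyshev.C_zero, map_ofNat]

theorem chebC_one : chebC a 1 = a := by simp [chebC]

theorem chebC_neg (n : ℤ) : chebC a (-n) = chebC a n := by simp [chebC, Chebyshev.C_neg]

theorem chebC_add_one (n : ℤ) : chebC a (n + 1) = a * chebC a n - chebC a (n - 1) := by
  simp [chebC, Chebyshev.C_add_one]

theorem chebC_mul (m n : ℤ) : chebC a m * chebC a n = chebC a (m + n) + chebC a (m - n) := by
  simp only [chebC]
  rw [← map_mul, Chebyshev.C_mul_C, map_add]

theorem chebC_eq_mul_sub (m n : ℤ) :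
    chebC a (m + n) = chebC a m * chebC a n - chebC a (m - n) := by
  rw [chebC_mul, add_sub_cancel_right]

theorem chebS_zero : chebS a 0 = 1 := by simp [chebS]

theorem chebS_one : chebS a 1 = a := by simp [chebS]

theorem chebS_neg_one : chebS a (-1) = 0 := by simp [chebS]

theorem chebS_add_one (n : ℤ) : chebS a (n + 1) = a * chebS a n - chebS a (n - 1) := by
  simp [chebS, Chebyshev.S_add_one]

theorem chebS_mul_comm (n : ℤ) : a * chebS a n = chebS a n * a := by
  have h : X * Chebyshev.S ℤ n = Chebyshev.S ℤ n * X := mul_comm _ _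
  simpa [chebS] using congrArg (aeval a) h

theorem chebS_add_two (n : ℤ) : chebS a (n + 2) = chebS a n + chebC a (n + 2) := by
  have h : Chebyshev.S ℤ (n + 2) = Chebyshev.S ℤ n + Chebyshev.C ℤ (n + 2) := by
    have h1 := Chebyshev.S_eq_X_mul_S_add_C ℤ (n + 1)
    have h2 := Chebyshev.S_add_two ℤ n
    rw [show n + 1 + 1 = n + 2 by ring] at h1
    linear_combination h1 - h2
  simp only [chebS, chebC, h, map_add]

variable {a} {q : ℕ} (h0 : chebC a q = 2) (h1 : chebC a (q - 1) = a)
include h0 h1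

/-- The recurrence is invariant under reversing the index, and both sides agree at `j = 0` and `j =
1`. -/
theorem chebC_sub (j : ℕ) : chebC a (q - j) = chebC a j := by
  induction j using Nat.twoStepInduction with
  | zero => simp [h0, chebC_zero]
  | one => simp [h1, chebC_one]
  | more j ih1 ih2 =>
    have e1 := chebC_add_one a (q - (j + 1 : ℕ))
    have e2 := chebC_add_one a (j + 1 : ℕ)
    push_cast at *
    rw [show (q : ℤ) - (j + 1) + 1 = q - j by ring,
      show (q : ℤ) - (j + 1) - 1 = q - (j + 2) by ring] at e1
    rw [show (j : ℤ) + 1 + 1 = j + 2 by ring, add_sub_cancel_right] at e2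
    rw [e2, ← ih1, ← ih2, e1]
    abel

/-- Together with `mul_chebS_sub_two`: multiplication by `a` exchanges the two increments up to a
factor 2. Hence the sequence alternating between them solves the Chebyshev recurrence, which is the
inductive step of `chebS_add`. -/
theorem mul_chebS_sub_one : a * chebS a (q - 1) = 2 * (chebS a (q - 2) + 1) := by
  have e1 := chebS_add_one a (q - 1)
  have e2 := chebS_add_two a (q - 2)
  rw [sub_add_cancel, sub_sub, one_add_one_eq_two] at e1
  rw [sub_add_cancel, h0] at e2
  have : a * chebS a (q - 1) = chebS a q + chebS a (q - 2) := by
    rw [e1, sub_add_cancel]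
  rw [this, e2, mul_add, mul_one, two_mul]
  abel

theorem mul_chebS_sub_two : a * (chebS a (q - 2) + 1) = 2 * chebS a (q - 1) := by
  have e1 := chebS_add_one a (q - 2)
  have e2 := chebS_add_two a (q - 3)
  rw [show (q : ℤ) - 2 + 1 = q - 1 by ring, show (q : ℤ) - 2 - 1 = q - 3 by ring] at e1
  rw [show (q : ℤ) - 3 + 2 = q - 1 by ring, h1] at e2
  have : a * chebS a (q - 2) = chebS a (q - 1) + chebS a (q - 3) := by
    rw [e1]
    noncomm_ring
  rw [mul_add, this, mul_one, add_assoc, ← e2, two_mul]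

theorem chebS_add (n : ℕ) : chebS a (n + q) =
    chebS a n + if Even n then chebS a (q - 2) + 1 else chebS a (q - 1) := by
  induction n using Nat.twoStepInduction with
  | zero =>
    have e2 := chebS_add_two a (q - 2)
    rw [sub_add_cancel, h0] at e2
    simp only [Nat.cast_zero, zero_add, chebS_zero, Even.zero, if_true, e2]
    rw [← one_add_one_eq_two (R := A)]
    abel
  | one =>
    have e2 := chebS_add_two a (q - 1)
    have e3 := chebC_add_one a q
    rw [h0, h1] at e3
    rw [show (q : ℤ) - 1 + 2 = q + 1 by ring, e3] at e2
    simp only [Nat.cast_one, chebS_one, Nat.not_even_one, if_false]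
    rw [add_comm, e2]
    noncomm_ring
  | more n ih1 ih2 =>
    have e1 := chebS_add_one a (n + 1 + q)
    have e2 := chebS_add_one a (n + 1)
    push_cast at *
    rw [show (n : ℤ) + 1 + q + 1 = n + 2 + q by ring,
      show (n : ℤ) + 1 + q - 1 = n + q by ring] at e1
    rw [show (n : ℤ) + 1 + 1 = n + 2 by ring, add_sub_cancel_right] at e2
    rw [e1, e2, ih1, ih2]
    by_cases hn : Even n
    · rw [if_pos hn, if_neg (by rw [Nat.even_add_one, not_not]; exact hn),
        if_pos (by simpa [Nat.even_add]),
        mul_add, mul_chebS_sub_one h0 h1]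
      noncomm_ring
    · rw [if_neg hn, if_pos (Nat.even_add_one.mpr hn),
        if_neg fun h ↦ hn ((Nat.even_add.mp h).mpr even_two),
        mul_add, mul_chebS_sub_two h0 h1]
      noncomm_ring

/-- With `q = 2 p + 1`, the sum `S_{2p-2k} + S_{2k-1}` does not depend on `k`: one step subtracts
`C_{2p-2k}` and adds `C_{2k+1}`, which are equal by reflection. The claim compares `k = 0` with `k =
p`. -/
theorem chebS_sub_one_of_odd (hq : Odd q) : chebS a (q - 1) = chebS a (q - 2) + 1 := by
  obtain ⟨p, rfl⟩ := hq
  have key (k : ℕ) : chebS a (2 * p - 2 * k) + chebS a (2 * k - 1) = chebS a (2 * p) := by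
    induction k with
    | zero => simp [chebS_neg_one]
    | succ k ih =>
      have e1 := chebS_add_two a (2 * k - 1)
      have e2 := chebS_add_two a (2 * p - 2 * k - 2)
      have e3 := chebC_sub h0 h1 (2 * k + 1)
      push_cast at *
      rw [show (2 : ℤ) * p + 1 - (2 * k + 1) = 2 * p - 2 * k by ring] at e3
      rw [sub_add_cancel, e3] at e2
      rw [show (2 : ℤ) * p - 2 * (k + 1) = 2 * p - 2 * k - 2 by ring,
        show (2 : ℤ) * (k + 1) - 1 = 2 * k - 1 + 2 by ring, e1, ← ih, e2,
        show (2 : ℤ) * k - 1 + 2 = 2 * k + 1 by ring]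
      abel
  have := key p
  rw [sub_self, chebS_zero] at this
  push_cast
  rw [add_sub_cancel_right, ← this, show (2 : ℤ) * p + 1 - 2 = 2 * p - 1 by ring, add_comm]

end Chebyshev

/-! ### Two criteria for periodicity, and the resulting growth. -/

section Period

variable {A : Type*} [Ring A] {a : A}

/-- With `a = z + 1/z`, the relation `C_{2m+1} = C_1` says that `(z^{2m} - 1)(z^{2m+2} - 1) = 0` up
to a unit. So the `2m`-difference of `C` has period `2m + 2` and conversely, and the `q`-difference
`d` has both periods, hence period 2. -/
theorem chebC_periodic_of_eq (htf : ∀ x : A, x = -x → x = 0) {m q : ℕ}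
    (h : chebC a (2 * m + 1) = a) (hq1 : 2 * m ∣ q)
    (hq2 : 2 * (m + 1) ∣ q) : chebC a q = 2 ∧ chebC a (q - 1) = a := by
  have r (k : ℤ) : chebC a (k + (2 * m + 1)) + chebC a (k - (2 * m + 1)) =
      chebC a (k + 1) + chebC a (k - 1) := by
    rw [← chebC_mul, h, ← chebC_mul, chebC_one]
  let g (k : ℤ) : A := chebC a (k + 2 * m) - chebC a k
  let g' (k : ℤ) : A := chebC a (k + 2 * (m + 1)) - chebC a k
  have hg (k : ℤ) : g (k + 2 * (m + 1)) = g k := by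
    have := r (k + 2 * m + 1)
    rw [show k + 2 * m + 1 + (2 * (m : ℤ) + 1) = k + 2 * (m + 1) + 2 * m by ring,
      show k + 2 * m + 1 - (2 * (m : ℤ) + 1) = k by ring,
      show k + 2 * m + 1 + 1 = k + 2 * ((m : ℤ) + 1) by ring, add_sub_cancel_right] at this
    rw [← sub_eq_zero] at this ⊢
    rw [← this]
    simp only [g]
    abel
  have hg' (k : ℤ) : g' (k + 2 * m) = g' k := by
    have := hg k
    rw [← sub_eq_zero] at this ⊢
    rw [← this]
    simp only [g, g']
    rw [show k + 2 * m + 2 * ((m : ℤ) + 1) = k + 2 * (m + 1) + 2 * m by ring]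
    abel
  have hgq (k : ℤ) : g (k + q) = g k := by
    obtain ⟨t, rfl⟩ := hq2
    have : Function.Periodic g (2 * (m + 1)) := hg
    simpa [mul_comm] using this.int_mul t k
  have hgq' (k : ℤ) : g' (k + q) = g' k := by
    obtain ⟨t, rfl⟩ := hq1
    have : Function.Periodic g' (2 * m) := hg'
    simpa [mul_comm] using this.int_mul t k
  let d (k : ℤ) : A := chebC a (k + q) - chebC a k
  have hd1 (k : ℤ) : d (k + 2 * m) = d k := by
    have := hgq k
    rw [← sub_eq_zero] at this ⊢
    rw [← this]
    simp only [g, d]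
    rw [add_right_comm]
    abel
  have hd2 (k : ℤ) : d (k + 2 * (m + 1)) = d k := by
    have := hgq' k
    rw [← sub_eq_zero] at this ⊢
    rw [← this]
    simp only [g', d]
    rw [add_right_comm]
    abel
  have hd : Function.Periodic d 2 := fun k ↦ by
    rw [← hd1, ← hd2 k]
    congr 1
    ring
  have hq : ∃ s, q = 2 * s := ⟨m * hq1.choose, by rw [← mul_assoc]; exact hq1.choose_spec⟩
  obtain ⟨s, hs⟩ := hq
  -- As `C` is an even function of its index, `d (-q) = -d 0` and `d (-q + 1) = -d (-1)`. Since `q`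
  -- is even, period 2 forces both differences to vanish in the absence of 2-torsion.
  have e0 : d 0 = d (-q) := by
    have := hd.int_mul s (-q)
    rw [← this]
    congr 1
    rw [hs]
    push_cast
    ring
  have e1 : d (-1) = d (-q + 1) := by
    have := hd.int_mul (s - 1) (-q + 1)
    rw [← this]
    congr 1
    rw [hs]
    push_cast
    ring
  simp only [d] at e0 e1
  rw [neg_add_cancel, zero_add, chebC_neg, ← neg_sub (chebC a q) (chebC a 0)] at e0
  rw [show (-q : ℤ) + 1 + q = 1 by ring, show (-q : ℤ) + 1 = -(q - 1) by ring, chebC_neg,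
    chebC_neg, show -1 + (q : ℤ) = q - 1 by ring,
    ← neg_sub (chebC a (q - 1)) (chebC a 1)] at e1
  rw [sub_eq_zero.mp (htf _ e0), sub_eq_zero.mp (htf _ e1), chebC_zero, chebC_one]
  exact ⟨rfl, rfl⟩

end Period

section Family

variable {ι : Type*} [Fintype ι] [DecidableEq ι] {a : Matrix ι ι ℤ}

theorem apply_chebC_mulVec {z : ℤ → (ι → ℤ) →ₗ[ℤ] ℤ}
    (hz : ∀ k y, z k (a.mulVec y) = z (k + 1) y + z (k - 1) y) (n : ℕ) (k : ℤ) (y : ι → ℤ) :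
    z k ((chebC a n).mulVec y) = z (k + n) y + z (k - n) y := by
  induction n using Nat.twoStepInduction generalizing k with
  | zero =>
    rw [Nat.cast_zero, chebC_zero, add_zero, sub_zero, ← one_add_one_eq_two, Matrix.add_mulVec,
      Matrix.one_mulVec, map_add]
  | one => rw [Nat.cast_one, chebC_one, hz]
  | more n ih1 ih2 =>
    have := chebC_add_one a (n + 1)
    rw [add_sub_cancel_right] at this
    push_cast at *
    rw [show (n : ℤ) + 2 = n + 1 + 1 by ring, this, Matrix.sub_mulVec, map_sub, ih1,
      ← Matrix.mulVec_mulVec, hz, ih2, ih2]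
    rw [show k + 1 + ((n : ℤ) + 1) = k + (n + 1 + 1) by ring,
      show k + 1 - ((n : ℤ) + 1) = k - n by ring, show k - 1 + ((n : ℤ) + 1) = k + n by ring,
      show k - 1 - ((n : ℤ) + 1) = k - (n + 1 + 1) by ring]
    ring

/-- Functionals indexed by `ℤ` on which `a` acts as the adjacency operator of an infinite path
satisfy `z k ∘ C_n(a) = z (k + n) + z (k - n)`. Period `q` turns this into `2 z k` for `n = q` and
into `z k ∘ a` for `n = q - 1`; a separating family transfers both identities to `a`. -/
theorem chebC_periodic_of_family {α : Type*} {z : α → ℤ → (ι → ℤ) →ₗ[ℤ] ℤ} {q : ℕ} (hq : 0 < q)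
    (hz : ∀ x k y, z x k (a.mulVec y) = z x (k + 1) y + z x (k - 1) y)
    (hper : ∀ x k y, z x (k + q) y = z x k y)
    (hsep : ∀ y, (∀ x k, z x k y = 0) → y = 0) :
    chebC a q = 2 ∧ chebC a (q - 1) = a := by
  have hper' (x k y) : z x (k - q) y = z x k y := by
    have := hper x (k - q) y
    rwa [sub_add_cancel, eq_comm] at this
  constructor
  · refine Matrix.ext_of_mulVec_single fun i ↦ ?_
    rw [← sub_eq_zero]
    refine hsep _ fun x k ↦ ?_
    rw [map_sub, apply_chebC_mulVec (hz x), hper, hper', ← one_add_one_eq_two, Matrix.add_mulVec,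
      Matrix.one_mulVec, map_add, sub_self]
  · refine Matrix.ext_of_mulVec_single fun i ↦ ?_
    rw [← sub_eq_zero]
    refine hsep _ fun x k ↦ ?_
    have e := apply_chebC_mulVec (hz x) (q - 1) k (Pi.single i 1)
    rw [Nat.cast_sub hq, Nat.cast_one, show k + ((q : ℤ) - 1) = k - 1 + q by ring,
      show k - ((q : ℤ) - 1) = k + 1 - q by ring, hper, hper'] at e
    rw [map_sub, e, hz]
    ring

end Family

section Growth

variable {ι : Type*} [Fintype ι] [DecidableEq ι] {E : Matrix ι ι ℕ} {t : ℕ → ι → ℕ} {q : ℕ}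

theorem cast_eq_vecMul_chebS (ht1 : t 1 = Matrix.vecMul (t 0) E)
    (ht : ∀ n, t (n + 2) + t n = Matrix.vecMul (t (n + 1)) E) (n : ℕ) :
    (fun j ↦ (t n j : ℤ)) =
      Matrix.vecMul (fun j ↦ (t 0 j : ℤ)) (chebS (E.map (Nat.cast : ℕ → ℤ)) n) := by
  have hcast (v : ι → ℕ) : (fun j ↦ ((Matrix.vecMul v E j : ℕ) : ℤ)) =
      Matrix.vecMul (fun j ↦ (v j : ℤ)) (E.map (Nat.cast : ℕ → ℤ)) := by
    funext j
    simp [Matrix.vecMul, dotProduct]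
  induction n using Nat.twoStepInduction with
  | zero => simp [chebS_zero]
  | one => rw [ht1, hcast, Nat.cast_one, chebS_one]
  | more n ih1 ih2 =>
    have e := chebS_add_one (E.map (Nat.cast : ℕ → ℤ)) (n + 1)
    rw [add_sub_cancel_right, show (n : ℤ) + 1 + 1 = n + 2 by ring, chebS_mul_comm] at e
    push_cast at *
    rw [e, Matrix.vecMul_sub, ← Matrix.vecMul_vecMul, ← ih1, ← ih2, ← hcast, ← ht]
    funext j
    simp

theorem exists_growth (hq : 2 ≤ q) (ht1 : t 1 = Matrix.vecMul (t 0) E)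
    (ht : ∀ n, t (n + 2) + t n = Matrix.vecMul (t (n + 1)) E)
    (h0 : chebC (E.map (Nat.cast : ℕ → ℤ)) q = 2)
    (h1 : chebC (E.map (Nat.cast : ℕ → ℤ)) (q - 1) = E.map (Nat.cast : ℕ → ℤ)) (l : ℕ) :
    ∃ w : ι → ℕ, (w = t (q - 1) ∨ w = t (q - 2) + t 0) ∧
      ∀ k : ℕ, t (k * q + l) = k • w + t l := by
  have hS := cast_eq_vecMul_chebS ht1 ht
  have hinj {v w : ι → ℕ} (h : (fun j ↦ (v j : ℤ)) = fun j ↦ (w j : ℤ)) : v = w :=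
    funext fun j ↦ by exact_mod_cast congrFun h j
  have hc1 : ((q - 1 : ℕ) : ℤ) = q - 1 := by rw [Nat.cast_sub (by omega), Nat.cast_one]
  have hc2 : ((q - 2 : ℕ) : ℤ) = q - 2 := by rw [Nat.cast_sub hq, Nat.cast_ofNat]
  have hstep (n : ℕ) : t (n + q) = t n + if Even n then t (q - 2) + t 0 else t (q - 1) := by
    apply hinj
    have e := hS (n + q)
    push_cast at e
    rw [chebS_add h0 h1] at e
    rw [e]
    split_ifs with hn
    · rw [Matrix.vecMul_add, ← hS, Matrix.vecMul_add, Matrix.vecMul_one, ← hc2, ← hS]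
      funext j
      simp
    · rw [Matrix.vecMul_add, ← hS, ← hc1, ← hS]
      funext j
      simp
  have hodd (h : Odd q) : t (q - 1) = t (q - 2) + t 0 := by
    apply hinj
    rw [hS, hc1, chebS_sub_one_of_odd h0 h1 h, Matrix.vecMul_add, Matrix.vecMul_one, ← hc2, ← hS]
    funext j
    simp
  let w := if Even l then t (q - 2) + t 0 else t (q - 1)
  -- For even `q` the parity of `k * q + l` is that of `l`; for odd `q` both increments coincide by
  -- `hodd`.
  have hw (k : ℕ) : (if Even (k * q + l) then t (q - 2) + t 0 else t (q - 1)) = w := by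
    rcases Nat.even_or_odd q with h | h
    · simp only [w, Nat.even_add, Nat.even_mul, h, or_true, true_iff]
    · simp only [w, hodd h, ite_self]
  refine ⟨w, ?_, fun k ↦ ?_⟩
  · by_cases hl : Even l
    · exact Or.inr (if_pos hl)
    · exact Or.inl (if_neg hl)
  · induction k with
    | zero => simp
    | succ k ih =>
      rw [show (k + 1) * q + l = k * q + l + q by ring, hstep, hw, ih, succ_nsmul]
      abel

end Growth

open TameDiagram

/-- The adjacency matrix of a diagram, with integer entries. -/
noncomputable abbrev adj (X : TameDiagram) : Matrix (Fin X.numVertices) (Fin X.numVertices) ℤ :=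
  X.adjacency.map (Nat.cast : ℕ → ℤ)

/-! ### The diagrams `Ẽ_6`, `Ẽ_7`, `Ẽ_8`, by matrix computation. -/

section Exceptional

/-- The adjacency matrix of a simple graph on the vertices `1, …, n`, given by its list of edges. -/
def listMatrix (n : ℕ) (l : List (ℕ × ℕ)) : Matrix (Fin n) (Fin n) ℤ :=
  Matrix.of fun i j ↦
    if ((i : ℕ) + 1, (j : ℕ) + 1) ∈ l ∨ ((j : ℕ) + 1, (i : ℕ) + 1) ∈ l then 1 else 0

theorem adj_eq_listMatrix (X : TameDiagram) (l : List (ℕ × ℕ))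
    (h : ∀ i j, X.Edge i j ↔ (i, j) ∈ l) : adj X = listMatrix X.numVertices l := by
  ext i j
  simp [adj, adjacency, listMatrix, h]

theorem matrix_eq_zero_of_eq_neg {n : ℕ} (x : Matrix (Fin n) (Fin n) ℤ) (h : x = -x) : x = 0 := by
  ext i j
  have : x i j = - x i j := congrFun (congrFun h i) j
  rw [Matrix.zero_apply]
  omega

/-- The adjacency matrix of `E6`. -/
def matE6 : Matrix (Fin 7) (Fin 7) ℤ :=
  listMatrix 7 [(1, 2), (2, 3), (3, 4), (4, 5), (3, 6), (6, 7)]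

/-- The adjacency matrix of `E7`. -/
def matE7 : Matrix (Fin 8) (Fin 8) ℤ :=
  listMatrix 8 [(8, 1), (1, 2), (2, 3), (3, 4), (4, 5), (5, 6), (3, 7)]

/-- The adjacency matrix of `E8`. -/
def matE8 : Matrix (Fin 9) (Fin 9) ℤ :=
  listMatrix 9 [(1, 2), (2, 3), (3, 4), (4, 5), (5, 6), (6, 7), (7, 9), (3, 8)]

theorem chebC_matE6_2 : chebC matE6 2 =
    !![-1, 0, 1, 0, 0, 0, 0;
      0, 0, 0, 1, 0, 1, 0;
      1, 0, 1, 0, 1, 0, 1;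
      0, 1, 0, 0, 0, 1, 0;
      0, 0, 1, 0, -1, 0, 0;
      0, 1, 0, 1, 0, 0, 0;
      0, 0, 1, 0, 0, 0, -1] := by
  rw [show (2 : ℤ) = 1 + 1 by norm_num, chebC_eq_mul_sub, sub_self, chebC_zero, chebC_one]
  decide +kernel

theorem chebC_matE6_3 : chebC matE6 3 =
    !![0, -1, 0, 1, 0, 1, 0;
      -1, 0, 1, 0, 1, 0, 1;
      0, 1, 0, 1, 0, 1, 0;
      1, 0, 1, 0, -1, 0, 1;
      0, 1, 0, -1, 0, 1, 0;
      1, 0, 1, 0, 1, 0, -1;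
      0, 1, 0, 1, 0, -1, 0] := by
  rw [show (3 : ℤ) = 2 + 1 by norm_num, chebC_eq_mul_sub,
    show (2 : ℤ) - 1 = 1 by norm_num, chebC_one, chebC_matE6_2]
  decide +kernel

theorem chebC_matE7_2 : chebC matE7 2 =
    !![0, 0, 1, 0, 0, 0, 0, 0;
      0, 0, 0, 1, 0, 0, 1, 1;
      1, 0, 1, 0, 1, 0, 0, 0;
      0, 1, 0, 0, 0, 1, 1, 0;
      0, 0, 1, 0, 0, 0, 0, 0;
      0, 0, 0, 1, 0, -1, 0, 0;
      0, 1, 0, 1, 0, 0, -1, 0;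
      0, 1, 0, 0, 0, 0, 0, -1] := by
  rw [show (2 : ℤ) = 1 + 1 by norm_num, chebC_eq_mul_sub, sub_self, chebC_zero, chebC_one]
  decide +kernel

theorem chebC_matE7_3 : chebC matE7 3 =
    !![0, 0, 0, 1, 0, 0, 1, -1;
      0, 0, 1, 0, 1, 0, 0, 0;
      0, 1, 0, 1, 0, 1, 0, 1;
      1, 0, 1, 0, 0, 0, 0, 0;
      0, 1, 0, 0, 0, -1, 1, 0;
      0, 0, 1, 0, -1, 0, 0, 0;
      1, 0, 0, 0, 1, 0, 0, 0;
      -1, 0, 1, 0, 0, 0, 0, 0] := by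
  rw [show (3 : ℤ) = 2 + 1 by norm_num, chebC_eq_mul_sub,
    show (2 : ℤ) - 1 = 1 by norm_num, chebC_one, chebC_matE7_2]
  decide +kernel

theorem chebC_matE7_4 : chebC matE7 4 =
    !![-1, 0, 1, 0, 1, 0, 0, 0;
      0, 1, 0, 1, 0, 1, 0, -1;
      1, 0, 1, 0, 1, 0, 0, 0;
      0, 1, 0, 1, 0, -1, 0, 1;
      1, 0, 1, 0, -1, 0, 0, 0;
      0, 1, 0, -1, 0, 0, 1, 0;
      0, 0, 0, 0, 0, 1, 1, 1;
      0, -1, 0, 1, 0, 0, 1, 0] := by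
  rw [show (4 : ℤ) = 2 + 2 by norm_num, chebC_eq_mul_sub, sub_self, chebC_zero, chebC_matE7_2]
  decide +kernel

theorem chebC_matE8_2 : chebC matE8 2 =
    !![-1, 0, 1, 0, 0, 0, 0, 0, 0;
      0, 0, 0, 1, 0, 0, 0, 1, 0;
      1, 0, 1, 0, 1, 0, 0, 0, 0;
      0, 1, 0, 0, 0, 1, 0, 1, 0;
      0, 0, 1, 0, 0, 0, 1, 0, 0;
      0, 0, 0, 1, 0, 0, 0, 0, 1;
      0, 0, 0, 0, 1, 0, 0, 0, 0;
      0, 1, 0, 1, 0, 0, 0, -1, 0;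
      0, 0, 0, 0, 0, 1, 0, 0, -1] := by
  rw [show (2 : ℤ) = 1 + 1 by norm_num, chebC_eq_mul_sub, sub_self, chebC_zero, chebC_one]
  decide +kernel

theorem chebC_matE8_3 : chebC matE8 3 =
    !![0, -1, 0, 1, 0, 0, 0, 1, 0;
      -1, 0, 1, 0, 1, 0, 0, 0, 0;
      0, 1, 0, 1, 0, 1, 0, 0, 0;
      1, 0, 1, 0, 0, 0, 1, 0, 0;
      0, 1, 0, 0, 0, 0, 0, 1, 1;
      0, 0, 1, 0, 0, 0, 0, 0, 0;
      0, 0, 0, 1, 0, 0, 0, 0, -1;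
      1, 0, 0, 0, 1, 0, 0, 0, 0;
      0, 0, 0, 0, 1, 0, -1, 0, 0] := by
  rw [show (3 : ℤ) = 2 + 1 by norm_num, chebC_eq_mul_sub,
    show (2 : ℤ) - 1 = 1 by norm_num, chebC_one, chebC_matE8_2]
  decide +kernel

theorem chebC_matE8_5 : chebC matE8 5 =
    !![0, 1, 0, 0, 0, 1, 0, -1, 0;
      1, 0, 0, 0, 1, 0, 1, 0, 0;
      0, 0, 0, 1, 0, 1, 0, 1, 1;
      0, 0, 1, 0, 1, 0, 0, 0, 0;
      0, 1, 0, 1, 0, 0, 0, 0, -1;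
      1, 0, 1, 0, 0, 0, -1, 0, 0;
      0, 1, 0, 0, 0, -1, 0, 1, 0;
      -1, 0, 1, 0, 0, 0, 1, 0, 0;
      0, 0, 1, 0, -1, 0, 0, 0, 0] := by
  rw [show (5 : ℤ) = 3 + 2 by norm_num, chebC_eq_mul_sub,
    show (3 : ℤ) - 2 = 1 by norm_num, chebC_one, chebC_matE8_3, chebC_matE8_2]
  decide +kernel

theorem chebC_matE8_6 : chebC matE8 6 =
    !![1, 0, 0, 0, 0, 0, 1, 0, 0;
      0, 1, 0, 0, 0, 1, 0, 0, 1;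
      0, 0, 1, 0, 1, 0, 1, 0, 0;
      0, 0, 0, 1, 0, 1, 0, 1, -1;
      0, 0, 1, 0, 1, 0, -1, 0, 0;
      0, 1, 0, 1, 0, -1, 0, 0, 0;
      1, 0, 1, 0, -1, 0, 0, 0, 0;
      0, 0, 0, 1, 0, 0, 0, 0, 1;
      0, 1, 0, -1, 0, 0, 0, 1, 0] := by
  rw [show (6 : ℤ) = 3 + 3 by norm_num, chebC_eq_mul_sub, sub_self, chebC_zero, chebC_matE8_3]
  decide +kernel

theorem chebC_E6 : chebC (adj E6) E6.q = 2 ∧ chebC (adj E6) (E6.q - 1) = adj E6 := by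
  -- `C_5(E) = E`, so `m = 2`; the periods 4 and 6 divide 12.
  have h : chebC matE6 (2 * (2 : ℕ) + 1) = matE6 := by
    rw [show (2 * (2 : ℕ) + 1 : ℤ) = 3 + 2 by norm_num, chebC_eq_mul_sub,
      show (3 : ℤ) - 2 = 1 by norm_num, chebC_one, chebC_matE6_2, chebC_matE6_3]
    decide +kernel
  have e : adj E6 = matE6 := adj_eq_listMatrix E6 _ fun _ _ ↦ Iff.rfl
  rw [e]
  exact chebC_periodic_of_eq (q := 12) matrix_eq_zero_of_eq_neg h (by norm_num) (by norm_num)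

theorem chebC_E7 : chebC (adj E7) E7.q = 2 ∧ chebC (adj E7) (E7.q - 1) = adj E7 := by
  -- `C_7(E) = E`, so `m = 3`; the periods 6 and 8 divide 72.
  have h : chebC matE7 (2 * (3 : ℕ) + 1) = matE7 := by
    rw [show (2 * (3 : ℕ) + 1 : ℤ) = 4 + 3 by norm_num, chebC_eq_mul_sub,
      show (4 : ℤ) - 3 = 1 by norm_num, chebC_one, chebC_matE7_3, chebC_matE7_4]
    decide +kernel
  have e : adj E7 = matE7 := adj_eq_listMatrix E7 _ fun _ _ ↦ Iff.rfl
  rw [e]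
  exact chebC_periodic_of_eq (q := 72) matrix_eq_zero_of_eq_neg h (by norm_num) (by norm_num)

theorem chebC_E8 : chebC (adj E8) E8.q = 2 ∧ chebC (adj E8) (E8.q - 1) = adj E8 := by
  -- `C_11(E) = E`, so `m = 5`; the periods 10 and 12 divide 60.
  have h : chebC matE8 (2 * (5 : ℕ) + 1) = matE8 := by
    rw [show (2 * (5 : ℕ) + 1 : ℤ) = 6 + 5 by norm_num, chebC_eq_mul_sub,
      show (6 : ℤ) - 5 = 1 by norm_num, chebC_one, chebC_matE8_5, chebC_matE8_6]
    decide +kernel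
  have e : adj E8 = matE8 := adj_eq_listMatrix E8 _ fun _ _ ↦ Iff.rfl
  rw [e]
  exact chebC_periodic_of_eq (q := 60) matrix_eq_zero_of_eq_neg h (by norm_num) (by norm_num)

end Exceptional

/-! ### Coordinates by vertex label, and the folding of a cycle onto a path. -/

/-- The coordinate of a vector at the vertex with label `m`. -/
def coord {N : ℕ} (m : ℕ) : (Fin N → ℤ) →ₗ[ℤ] ℤ :=
  if h : m - 1 < N then LinearMap.proj ⟨m - 1, h⟩ else 0

theorem coord_val_add_one {N : ℕ} (i : Fin N) (y : Fin N → ℤ) : coord (i + 1) y = y i := by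
  have h : (i : ℕ) + 1 - 1 < N := by simp
  rw [coord, dif_pos h]
  simp

theorem eq_zero_of_coord {N : ℕ} {y : Fin N → ℤ} (h : ∀ m, 1 ≤ m → m ≤ N → coord m y = 0) :
    y = 0 := by
  ext i
  exact (coord_val_add_one i y).symm.trans (h _ (by omega) (by omega))

theorem coord_mulVec (X : TameDiagram) (y : Fin X.numVertices → ℤ) {m : ℕ} (h1 : 1 ≤ m)
    (h2 : m ≤ X.numVertices) (s : Finset ℕ)
    (hs : ∀ l, l ∈ s ↔ 1 ≤ l ∧ l ≤ X.numVertices ∧ (X.Edge m l ∨ X.Edge l m)) :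
    coord m ((adj X).mulVec y) = ∑ l ∈ s, coord l y := by
  classical
  obtain ⟨i, rfl⟩ : ∃ i : Fin X.numVertices, m = i + 1 := ⟨⟨m - 1, by omega⟩, by simp; omega⟩
  have e : s = (Finset.univ.filter fun j : Fin X.numVertices ↦
      X.Edge (i + 1) (j + 1) ∨ X.Edge (j + 1) (i + 1)).image
        fun j : Fin X.numVertices ↦ (j : ℕ) + 1 := by
    ext l
    rw [hs, Finset.mem_image]
    constructor
    · rintro ⟨h3, h4, h5⟩
      refine ⟨⟨l - 1, by omega⟩, ?_, by simp; omega⟩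
      simpa [Nat.sub_add_cancel h3] using h5
    · rintro ⟨j, h3, rfl⟩
      exact ⟨by omega, by omega, by simpa using h3⟩
  rw [coord_val_add_one, e, Finset.sum_image fun a _ b _ h ↦ Fin.ext (by omega),
    Finset.sum_filter, Matrix.mulVec, dotProduct]
  refine Finset.sum_congr rfl fun j _ ↦ ?_
  rw [coord_val_add_one]
  simp only [adj, adjacency, Matrix.map_apply, Matrix.of_apply]
  split_ifs <;> simp

theorem adjacency_eq_one {X : TameDiagram} {i j : Fin X.numVertices}
    (h : X.Edge (i + 1) (j + 1) ∨ X.Edge (j + 1) (i + 1)) : X.adjacency i j = 1 := by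
  simp [adjacency, h]

theorem adjacency_symm (X : TameDiagram) (i j : Fin X.numVertices) :
    X.adjacency i j = X.adjacency j i := by
  simp only [adjacency, Matrix.of_apply]
  congr 1
  exact propext or_comm

/-- The reflection of the position `k` on a cycle of length `T` to the interval `[0, T / 2]`. -/
def fold (T : ℕ) (k : ℤ) : ℕ := min (k % T).toNat (T - (k % T).toNat)

theorem fold_add_mul (T : ℕ) (k c : ℤ) : fold T (k + T * c) = fold T k := by simp [fold]

theorem add_one_emod {T : ℕ} (hT : 0 < T) (k : ℤ) :
    (k + 1) % T = if k % T + 1 = T then 0 else k % T + 1 := by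
  have h0 := Int.emod_nonneg k (b := T) (by omega)
  have h1 := Int.emod_lt_of_pos k (b := T) (by omega)
  split_ifs with h
  · rw [← Int.emod_add_emod, h, Int.emod_self]
  · rw [← Int.emod_add_emod]
    exact Int.emod_eq_of_lt (by omega) (by omega)

theorem sub_one_emod {T : ℕ} (hT : 0 < T) (k : ℤ) :
    (k - 1) % T = if k % T = 0 then (T : ℤ) - 1 else k % T - 1 := by
  have h0 := Int.emod_nonneg k (b := T) (by omega)
  have h1 := Int.emod_lt_of_pos k (b := T) (by omega)
  split_ifs with h
  · rw [← Int.emod_sub_emod, h, ← Int.add_emod_right]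
    exact (congrArg (· % (T : ℤ)) (by ring)).trans
      (Int.emod_eq_of_lt (a := T - 1) (by omega) (by omega))
  · rw [← Int.emod_sub_emod]
    exact Int.emod_eq_of_lt (by omega) (by omega)

theorem fold_le {T : ℕ} (k : ℤ) : 2 * fold T k ≤ T := by
  rw [fold]
  omega

theorem fold_eq {T r : ℕ} {k : ℤ} (h : k % T = r) : fold T k = min r (T - r) := by
  rw [fold, h, Int.toNat_natCast]

/-- Which of `k ± 1` goes to `a` and which to `b` depends on the half of the cycle containing `k`,
so only the unordered pair is determined. At the far end an even cycle reflects, while an odd one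
has two adjacent points with the same image, which acts as a loop. -/
theorem fold_add_one_or {T : ℕ} (hT : 2 ≤ T) (k : ℤ) {a b : ℕ}
    (ha : a = if fold T k = 0 then 1 else fold T k - 1)
    (hb : b = if 2 * fold T k = T then fold T k - 1 else
      if 2 * fold T k + 1 = T then fold T k else fold T k + 1) :
    fold T (k + 1) = b ∧ fold T (k - 1) = a ∨ fold T (k + 1) = a ∧ fold T (k - 1) = b := by
  have h0 := Int.emod_nonneg k (b := T) (by omega)
  have h1 := Int.emod_lt_of_pos k (b := T) (by omega)
  obtain ⟨r, hr⟩ : ∃ r : ℕ, k % T = r := ⟨(k % T).toNat, by omega⟩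
  have e1 : fold T (k + 1) = min (if r + 1 = T then 0 else r + 1)
      (T - if r + 1 = T then 0 else r + 1) := by
    refine fold_eq ?_
    rw [add_one_emod (by omega), hr]
    split_ifs <;> omega
  have e2 : fold T (k - 1) = min (if r = 0 then T - 1 else r - 1)
      (T - if r = 0 then T - 1 else r - 1) := by
    refine fold_eq ?_
    rw [sub_one_emod (by omega), hr]
    split_ifs <;> omega
  rw [hr] at h1
  rw [fold_eq hr] at ha hb
  rw [e1, e2]
  clear e1 e2 h0 hr k
  rcases lt_trichotomy (2 * r) T with h | h | h
  · rw [min_eq_left (by omega)] at ha hb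
    left
    constructor
    · rw [if_neg (by omega), hb, if_neg (by omega)]
      split_ifs <;> omega
    · rw [ha]
      split_ifs <;> omega
  · rw [min_eq_left (by omega)] at ha hb
    left
    rw [if_pos (by omega)] at hb
    rw [if_neg (by omega)] at ha
    constructor
    · split_ifs <;> omega
    · rw [if_neg (by omega)]
      omega
  · rw [min_eq_right (by omega)] at ha hb
    right
    rw [if_neg (by omega)] at ha
    rw [if_neg (by omega)] at hb
    constructor
    · split_ifs <;> omega
    · rw [if_neg (by omega)]
      split_ifs at hb <;> omega

theorem apply_fold_add_one_add {T : ℕ} (hT : 2 ≤ T) (F : ℕ → ℤ) (k : ℤ) :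
    F (fold T (k + 1)) + F (fold T (k - 1)) =
      F (if fold T k = 0 then 1 else fold T k - 1) +
        F (if 2 * fold T k = T then fold T k - 1 else
          if 2 * fold T k + 1 = T then fold T k else fold T k + 1) := by
  rcases fold_add_one_or hT k rfl rfl with ⟨h1, h2⟩ | ⟨h1, h2⟩
  · rw [h1, h2, add_comm]
  · rw [h1, h2]

theorem fold_natCast {T m : ℕ} (hT : 0 < T) (h : 2 * m ≤ T) : fold T m = m := by
  rw [fold_eq (Int.emod_eq_of_lt (by omega) (by omega)), min_eq_left (by omega)]

/-! ### The diagrams `Ã_n`. -/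

section Cycle

theorem coord_mulVec_A {n : ℕ} (hn : 2 ≤ n) (y : Fin (A n hn).numVertices → ℤ) {m : ℕ}
    (h1 : 1 ≤ m) (h2 : m ≤ n + 1) : coord m ((adj (A n hn)).mulVec y) =
      coord (if m = n + 1 then 1 else m + 1) y + coord (if m = 1 then n + 1 else m - 1) y := by
  rw [coord_mulVec (A n hn) y h1 h2
    {if m = n + 1 then 1 else m + 1, if m = 1 then n + 1 else m - 1}, Finset.sum_pair]
  · split_ifs <;> omega
  · intro l
    simp only [Finset.mem_insert, Finset.mem_singleton, Edge, numVertices]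
    split_ifs <;> omega

theorem chebC_A {n : ℕ} (hn : 2 ≤ n) : chebC (adj (A n hn)) (A n hn).q = 2 ∧
    chebC (adj (A n hn)) ((A n hn).q - 1) = adj (A n hn) := by
  refine chebC_periodic_of_family (α := Unit)
    (z := fun _ k ↦ coord ((k % ((n + 1 : ℕ) : ℤ)).toNat + 1)) (Nat.succ_pos n)
    (fun _ k y ↦ ?_) (fun _ k y ↦ ?_) fun y h ↦ eq_zero_of_coord fun m h1 h2 ↦ ?_
  · have h0 := Int.emod_nonneg k (b := (n + 1 : ℕ)) (by omega)
    have h1 := Int.emod_lt_of_pos k (b := (n + 1 : ℕ)) (by omega)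
    rw [coord_mulVec_A hn y (by omega) (by omega), add_one_emod (by omega),
      sub_one_emod (by omega)]
    congr 3 <;> split_ifs <;> omega
  · simp only [q, Int.add_emod_right]
  · have := h () (m - 1 : ℕ)
    change m ≤ n + 1 at h2
    rwa [Int.emod_eq_of_lt (by omega) (by omega), Int.toNat_natCast, Nat.sub_add_cancel h1] at this

end Cycle

/-! ### The diagrams `D̃_n`. -/

/-- The sequence `1, 0, -1, 0` of period four. -/
def quarter (k : ℤ) : ℤ := if k % 4 = 0 then 1 else if k % 4 = 2 then -1 else 0

theorem quarter_add_one_add (k : ℤ) : quarter (k + 1) + quarter (k - 1) = 0 := by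
  rw [quarter, quarter]
  split_ifs <;> omega

theorem quarter_add_mul (k c : ℤ) : quarter (k + 4 * c) = quarter k := by
  simp [quarter]

section D

variable {n : ℕ} (hn : 4 ≤ n) (y : Fin (D n hn).numVertices → ℤ)

/-- The sum of the coordinates at distance `m` from the left end of the diagram. -/
def pathD (n : ℕ) {N : ℕ} (m : ℕ) : (Fin N → ℤ) →ₗ[ℤ] ℤ :=
  if m = 0 then coord 1 + coord 2 else if m + 2 = n then coord n + coord (n + 1)
  else coord (m + 2)

theorem coord_mulVec_D_left {m : ℕ} (h : m = 1 ∨ m = 2) :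
    coord m ((adj (D n hn)).mulVec y) = coord 3 y := by
  rw [coord_mulVec (D n hn) y (by omega) (by simp only [numVertices]; omega) {3},
    Finset.sum_singleton]
  intro l
  simp only [Finset.mem_singleton, Edge, numVertices]
  omega

theorem coord_mulVec_D_right {m : ℕ} (h : m = n ∨ m = n + 1) :
    coord m ((adj (D n hn)).mulVec y) = coord (n - 1) y := by
  rw [coord_mulVec (D n hn) y (by omega) (by simp only [numVertices]; omega) {n - 1},
    Finset.sum_singleton]
  intro l
  simp only [Finset.mem_singleton, Edge, numVertices]
  omega

theorem coord_mulVec_D {m : ℕ} (h1 : 3 ≤ m) (h2 : m < n) :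
    coord m ((adj (D n hn)).mulVec y) = pathD n (m - 3) y + pathD n (m - 1) y := by
  have hl : pathD n (m - 3) y =
      ∑ l ∈ (if m = 3 then {1, 2} else {m - 1} : Finset ℕ), coord l y := by
    rw [pathD]
    split_ifs <;> first | omega | (rw [Finset.sum_singleton]; congr 2; omega) | simp
  have hr : pathD n (m - 1) y =
      ∑ l ∈ (if m + 1 = n then {n, n + 1} else {m + 1} : Finset ℕ), coord l y := by
    rw [pathD]
    split_ifs <;> first | omega | (rw [Finset.sum_singleton]; congr 2; omega) | simp
  rw [hl, hr, coord_mulVec (D n hn) y (by omega) (by simp only [numVertices]; omega)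
    ((if m = 3 then {1, 2} else {m - 1}) ∪ (if m + 1 = n then {n, n + 1} else {m + 1})),
    Finset.sum_union]
  · rw [Finset.disjoint_left]
    intro l
    split_ifs <;> simp only [Finset.mem_insert, Finset.mem_singleton] <;> omega
  · intro l
    simp only [Finset.mem_union, Edge, numVertices]
    constructor
    · rintro (h | h)
      · have : l + 1 = m ∨ m = 3 ∧ l = 1 := by
          split_ifs at h <;> simp only [Finset.mem_insert, Finset.mem_singleton] at h <;> omega
        rcases this with rfl | ⟨rfl, rfl⟩
        · exact ⟨by omega, by omega, .inr (by omega)⟩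
        · exact ⟨by omega, by omega, .inr (by omega)⟩
      · have : l = m + 1 ∨ m + 1 = n ∧ l = n + 1 := by
          split_ifs at h <;> simp only [Finset.mem_insert, Finset.mem_singleton] at h <;> omega
        rcases this with rfl | ⟨rfl, rfl⟩
        · exact ⟨by omega, by omega, .inl (by omega)⟩
        · exact ⟨by omega, by omega, .inl (by omega)⟩
    · rintro ⟨h3, h4, h5 | h5⟩
      · right
        have : l = m + 1 ∨ m + 1 = n ∧ l = n + 1 := by omega
        split_ifs <;> simp only [Finset.mem_insert, Finset.mem_singleton] <;> omega
      · left
        have : l + 1 = m ∨ m = 3 ∧ l = 1 := by omega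
        clear h5
        split_ifs <;> simp only [Finset.mem_insert, Finset.mem_singleton] <;> omega

theorem pathD_mulVec {m : ℕ} (h : 2 * m ≤ 2 * (n - 2)) :
    pathD n m ((adj (D n hn)).mulVec y) = pathD n (if m = 0 then 1 else m - 1) y +
      pathD n (if 2 * m = 2 * (n - 2) then m - 1 else
        if 2 * m + 1 = 2 * (n - 2) then m else m + 1) y := by
  rcases Nat.eq_zero_or_pos m with rfl | h0
  · rw [if_pos rfl, if_neg (by omega), if_neg (by omega), pathD, if_pos rfl, LinearMap.add_apply,
      coord_mulVec_D_left hn y (by simp), coord_mulVec_D_left hn y (by simp), pathD,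
      if_neg (by omega), if_neg (by omega)]
  · rcases eq_or_ne (m + 2) n with h2 | h2
    · rw [if_neg (by omega), if_pos (by omega), pathD, if_neg (by omega), if_pos h2,
        LinearMap.add_apply, coord_mulVec_D_right hn y (by simp),
        coord_mulVec_D_right hn y (by simp), pathD,
        if_neg (by omega), if_neg (by omega), show m - 1 + 2 = n - 1 by omega]
    · rw [if_neg (by omega), if_neg (by omega), if_neg (by omega), pathD, if_neg (by omega),
        if_neg h2, coord_mulVec_D hn y (by omega) (by omega)]
      rfl

/-- The difference of the two coordinates at a fork is killed by the adjacency matrix, so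
multiplying it by `quarter` gives a family of period 4. Adding the two coordinates at each fork
turns the diagram into a path with reflecting ends, the folding of a cycle of length `2 (n - 2)`.
Both periods divide `q`. -/
theorem chebC_D : chebC (adj (D n hn)) (D n hn).q = 2 ∧
    chebC (adj (D n hn)) ((D n hn).q - 1) = adj (D n hn) := by
  obtain ⟨c, hc⟩ : 4 ∣ (D n hn).q := by
    simp only [q]
    split_ifs with h
    · obtain ⟨r, rfl⟩ := h
      omega
    · omega
  obtain ⟨d, hd⟩ : 2 * (n - 2) ∣ (D n hn).q := by
    simp only [q]
    split_ifs with h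
    · exact ⟨1, by omega⟩
    · exact ⟨4, by omega⟩
  have hq : 0 < (D n hn).q := by
    simp only [q]
    split_ifs <;> omega
  refine chebC_periodic_of_family (α := Fin 3)
    (z := fun x k ↦ ![quarter k • (coord 1 - coord 2), quarter k • (coord n - coord (n + 1)),
      pathD n (fold (2 * (n - 2)) k)] x) hq (fun x k y ↦ ?_) (fun x k y ↦ ?_) fun y h ↦ ?_
  · fin_cases x
    · simp [coord_mulVec_D_left, ← add_mul, quarter_add_one_add]
    · simp [coord_mulVec_D_right, ← add_mul, quarter_add_one_add]
    · exact (pathD_mulVec hn y (fold_le k)).trans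
        (apply_fold_add_one_add (by omega) (fun m ↦ pathD n m y) k).symm
  · fin_cases x
    · simp [hc, quarter_add_mul]
    · simp [hc, quarter_add_mul]
    · simp only [hd]
      push_cast
      exact congrArg (fun m ↦ pathD n m y) (by exact_mod_cast fold_add_mul (2 * (n - 2)) k d)
  · have h1 : coord 1 y - coord 2 y = 0 := by simpa [quarter] using h 0 0
    have h2 : coord n y - coord (n + 1) y = 0 := by simpa [quarter] using h 1 0
    have h3 (m : ℕ) (hm : m ≤ n - 2) : pathD n m y = 0 := by
      have : pathD n (fold (2 * (n - 2)) m) y = 0 := h 2 m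
      rwa [fold_natCast (by omega) (by omega)] at this
    refine eq_zero_of_coord fun m hm1 hm2 ↦ ?_
    change m ≤ n + 1 at hm2
    have h4 : coord 1 y + coord 2 y = 0 := h3 0 (by omega)
    have h5 : coord n y + coord (n + 1) y = 0 := by
      have := h3 (n - 2) le_rfl
      rwa [pathD, if_neg (by omega), if_pos (by omega)] at this
    rcases eq_or_ne m 1 with rfl | n1
    · omega
    rcases eq_or_ne m 2 with rfl | n2
    · omega
    rcases eq_or_ne m n with rfl | n3
    · omega
    rcases eq_or_ne m (n + 1) with rfl | n4
    · omega
    have := h3 (m - 2) (by omega)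
    rwa [pathD, if_neg (by omega), if_neg (by omega), Nat.sub_add_cancel (by omega)] at this

end D

/-! ### The diagrams `D̃L_n`. -/

section DL

variable {n : ℕ} (hn : 3 ≤ n) (y : Fin (DL n hn).numVertices → ℤ)

/-- The sum of the coordinates at distance `m` from the left end of the diagram. -/
def pathDL {N : ℕ} (m : ℕ) : (Fin N → ℤ) →ₗ[ℤ] ℤ :=
  if m = 0 then coord 1 + coord 2 else coord (m + 2)

theorem coord_mulVec_DL_left {m : ℕ} (h : m = 1 ∨ m = 2) :
    coord m ((adj (DL n hn)).mulVec y) = coord 3 y := by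
  rw [coord_mulVec (DL n hn) y (by omega) (by simp only [numVertices]; omega) {3},
    Finset.sum_singleton]
  intro l
  simp only [Finset.mem_singleton, Edge, numVertices]
  omega

theorem coord_mulVec_DL {m : ℕ} (h1 : 3 ≤ m) (h2 : m ≤ n) :
    coord m ((adj (DL n hn)).mulVec y) =
      pathDL (m - 3) y + pathDL (if m = n then m - 2 else m - 1) y := by
  have hl : pathDL (m - 3) y =
      ∑ l ∈ (if m = 3 then {1, 2} else {m - 1} : Finset ℕ), coord l y := by
    rw [pathDL]
    split_ifs <;> first | omega | (rw [Finset.sum_singleton]; congr 2; omega) | simp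
  have hr : pathDL (if m = n then m - 2 else m - 1) y =
      ∑ l ∈ ({if m = n then m else m + 1} : Finset ℕ), coord l y := by
    rw [pathDL, if_neg (by split_ifs <;> omega), Finset.sum_singleton]
    congr 2
    split_ifs <;> omega
  rw [hl, hr, coord_mulVec (DL n hn) y (by omega) (by simp only [numVertices]; omega)
    ((if m = 3 then {1, 2} else {m - 1}) ∪ {if m = n then m else m + 1}),
    Finset.sum_union]
  · rw [Finset.disjoint_left]
    intro l
    split_ifs <;> simp only [Finset.mem_insert, Finset.mem_singleton] <;> omega
  · intro l
    simp only [Finset.mem_union, Edge, numVertices]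
    split_ifs <;> simp only [Finset.mem_insert, Finset.mem_singleton] <;> omega

theorem pathDL_mulVec {m : ℕ} (h : 2 * m ≤ 2 * n - 3) :
    pathDL m ((adj (DL n hn)).mulVec y) = pathDL (if m = 0 then 1 else m - 1) y +
      pathDL (if 2 * m = 2 * n - 3 then m - 1 else
        if 2 * m + 1 = 2 * n - 3 then m else m + 1) y := by
  rcases Nat.eq_zero_or_pos m with rfl | h0
  · rw [if_pos rfl, if_neg (by omega), if_neg (by omega), pathDL, if_pos rfl, LinearMap.add_apply,
      coord_mulVec_DL_left hn y (by simp), coord_mulVec_DL_left hn y (by simp), pathDL,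
      if_neg (by omega)]
  · rw [if_neg (by omega), if_neg (by omega), pathDL, if_neg (by omega),
      coord_mulVec_DL hn y (by omega) (by omega)]
    congr 3
    split_ifs <;> omega

/-- As for `chebC_D`, with a single fork. The loop at the other end makes the folded cycle one of
odd length `2 n - 3`, and `q` is the product of the periods 4 and `2 n - 3`. -/
theorem chebC_DL : chebC (adj (DL n hn)) (DL n hn).q = 2 ∧
    chebC (adj (DL n hn)) ((DL n hn).q - 1) = adj (DL n hn) := by
  have hc : (DL n hn).q = 4 * (2 * n - 3) := by
    simp only [q]
    omega
  refine chebC_periodic_of_family (α := Fin 2)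
    (z := fun x k ↦ ![quarter k • (coord 1 - coord 2), pathDL (fold (2 * n - 3) k)] x)
    (by omega) (fun x k y ↦ ?_) (fun x k y ↦ ?_) fun y h ↦ ?_
  · fin_cases x
    · simp [coord_mulVec_DL_left, ← add_mul, quarter_add_one_add]
    · exact (pathDL_mulVec hn y (fold_le k)).trans
        (apply_fold_add_one_add (by omega) (fun m ↦ pathDL m y) k).symm
  · fin_cases x
    · simp [hc, quarter_add_mul]
    · refine congrArg (fun m ↦ pathDL m y) ?_
      rw [hc, Nat.cast_mul, mul_comm ((4 : ℕ) : ℤ)]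
      exact fold_add_mul _ k _
  · have h1 : coord 1 y - coord 2 y = 0 := by simpa [quarter] using h 0 0
    have h3 (m : ℕ) (hm : m ≤ n - 2) : pathDL m y = 0 := by
      have : pathDL (fold (2 * n - 3) m) y = 0 := h 1 m
      rwa [fold_natCast (by omega) (by omega)] at this
    refine eq_zero_of_coord fun m hm1 hm2 ↦ ?_
    change m ≤ n at hm2
    have h4 : coord 1 y + coord 2 y = 0 := h3 0 (by omega)
    rcases eq_or_ne m 1 with rfl | n1
    · omega
    rcases eq_or_ne m 2 with rfl | n2
    · omega
    have := h3 (m - 2) (by omega)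
    rwa [pathDL, if_neg (by omega), Nat.sub_add_cancel (by omega)] at this

end DL

theorem chebC_adj (X : TameDiagram) :
    chebC (adj X) X.q = 2 ∧ chebC (adj X) (X.q - 1) = adj X := by
  cases X with
  | A n hn => exact chebC_A hn
  | D n hn => exact chebC_D hn
  | E6 => exact chebC_E6
  | E7 => exact chebC_E7
  | E8 => exact chebC_E8
  | DL n hn => exact chebC_DL hn

theorem two_le_q (X : TameDiagram) : 2 ≤ X.q := by
  cases X with
  | D n hn => simp only [q]; split_ifs <;> omega
  | _ => simp only [q]; omega

/-! ### The additive function `δ`, and neighbours of vertices. -/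

/-- The positive additive function on the vertices of the diagram, by vertex label. -/
def additiveFun : TameDiagram → ℕ → ℕ
  | A _ _, _ => 1
  | D n _, m => if m = 1 ∨ m = 2 ∨ m = n ∨ m = n + 1 then 1 else 2
  | E6, m => [0, 1, 2, 3, 2, 1, 2].getD m 1
  | E7, m => [0, 2, 3, 4, 3, 2, 1, 2].getD m 1
  | E8, m => [0, 2, 4, 6, 5, 4, 3, 2, 3].getD m 1
  | DL _ _, m => if m = 1 ∨ m = 2 then 1 else 2

theorem additiveFun_pos (X : TameDiagram) (i : Fin X.numVertices) :
    0 < additiveFun X (i + 1) := by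
  cases X with
  | A n hn => exact one_pos
  | D n hn => simp only [additiveFun]; split_ifs <;> omega
  | DL n hn => simp only [additiveFun]; split_ifs <;> omega
  | E6 => revert i; change ∀ i : Fin 7, _; decide
  | E7 => revert i; change ∀ i : Fin 8, _; decide
  | E8 => revert i; change ∀ i : Fin 9, _; decide

theorem sum_additiveFun_of_coord {X : TameDiagram}
    (h : ∀ m, 1 ≤ m → m ≤ X.numVertices →
      coord m ((adj X).mulVec fun i ↦ (additiveFun X (i + 1) : ℤ)) = 2 * additiveFun X m)
    (i : Fin X.numVertices) :
    ∑ j, X.adjacency i j * additiveFun X (j + 1) = 2 * additiveFun X (i + 1) := by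
  have := h (i + 1) (by omega) (by omega)
  rw [coord_val_add_one] at this
  simp only [Matrix.mulVec, dotProduct, adj, Matrix.map_apply] at this
  exact_mod_cast this

theorem coord_natCast {N m : ℕ} (f : ℕ → ℕ) (h1 : 1 ≤ m) (h2 : m ≤ N) :
    coord m (fun i : Fin N ↦ (f (i + 1) : ℤ)) = f m := by
  obtain ⟨i, rfl⟩ : ∃ i : Fin N, m = i + 1 := ⟨⟨m - 1, by omega⟩, by simp; omega⟩
  rw [coord_val_add_one]

theorem pathD_additiveFun {n : ℕ} (hn : 4 ≤ n) {m : ℕ} (hm : m + 2 ≤ n) :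
    pathD n m (fun i : Fin (D n hn).numVertices ↦ (additiveFun (D n hn) (i + 1) : ℤ)) = 2 := by
  rw [pathD]
  split_ifs with h1 h2
  · rw [LinearMap.add_apply, coord_natCast _ (by omega) (by simp only [numVertices]; omega),
      coord_natCast _ (by omega) (by simp only [numVertices]; omega)]
    simp [additiveFun]
  · rw [LinearMap.add_apply, coord_natCast _ (by omega) (by simp only [numVertices]; omega),
      coord_natCast _ (by omega) (by simp only [numVertices]; omega)]
    simp [additiveFun]
  · rw [coord_natCast _ (by omega) (by simp only [numVertices]; omega)]
    rw [additiveFun, if_neg (by omega)]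
    rfl

theorem pathDL_additiveFun {n : ℕ} (hn : 3 ≤ n) {m : ℕ} (hm : m + 2 ≤ n) :
    pathDL m (fun i : Fin (DL n hn).numVertices ↦ (additiveFun (DL n hn) (i + 1) : ℤ)) = 2 := by
  rw [pathDL]
  split_ifs with h1
  · rw [LinearMap.add_apply, coord_natCast _ (by omega) (by simp only [numVertices]; omega),
      coord_natCast _ (by omega) (by simp only [numVertices]; omega)]
    simp [additiveFun]
  · rw [coord_natCast _ (by omega) (by simp only [numVertices]; omega)]
    rw [additiveFun, if_neg (by omega)]
    rfl

theorem sum_additiveFun_of_listMatrix {X : TameDiagram} {l : List (ℕ × ℕ)}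
    (hl : ∀ i j, X.Edge i j ↔ (i, j) ∈ l)
    (h : ∀ i, (listMatrix X.numVertices l).mulVec (fun i ↦ (additiveFun X (i + 1) : ℤ)) i =
      2 * additiveFun X (i + 1)) (i : Fin X.numVertices) :
    ∑ j, X.adjacency i j * additiveFun X (j + 1) = 2 * additiveFun X (i + 1) := by
  have := h i
  rw [← adj_eq_listMatrix X l hl] at this
  simp only [Matrix.mulVec, dotProduct, adj, Matrix.map_apply] at this
  exact_mod_cast this

theorem sum_additiveFun (X : TameDiagram) (i : Fin X.numVertices) :
    ∑ j, X.adjacency i j * additiveFun X (j + 1) = 2 * additiveFun X (i + 1) := by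
  cases X with
  | A n hn =>
    refine sum_additiveFun_of_coord (fun m h1 h2 ↦ ?_) i
    change m ≤ n + 1 at h2
    rw [coord_mulVec_A hn _ h1 h2,
      coord_natCast _ (by split_ifs <;> omega) (by simp only [numVertices]; split_ifs <;> omega),
      coord_natCast _ (by split_ifs <;> omega) (by simp only [numVertices]; split_ifs <;> omega)]
    rfl
  | D n hn =>
    refine sum_additiveFun_of_coord (fun m h1 h2 ↦ ?_) i
    change m ≤ n + 1 at h2
    by_cases hl : m = 1 ∨ m = 2
    · rw [coord_mulVec_D_left hn _ hl,
        coord_natCast _ (by omega) (by simp only [numVertices]; omega), additiveFun,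
        additiveFun, if_neg (by omega), if_pos (by omega)]
      rfl
    by_cases hr : m = n ∨ m = n + 1
    · rw [coord_mulVec_D_right hn _ hr,
        coord_natCast _ (by omega) (by simp only [numVertices]; omega), additiveFun,
        additiveFun, if_neg (by omega), if_pos (by omega)]
      rfl
    rw [coord_mulVec_D hn _ (by omega) (by omega), pathD_additiveFun hn (by omega),
      pathD_additiveFun hn (by omega), additiveFun, if_neg (by omega)]
    rfl
  | DL n hn =>
    refine sum_additiveFun_of_coord (fun m h1 h2 ↦ ?_) i
    change m ≤ n at h2
    by_cases hl : m = 1 ∨ m = 2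
    · rw [coord_mulVec_DL_left hn _ hl,
        coord_natCast _ (by omega) (by simp only [numVertices]; omega), additiveFun,
        additiveFun, if_neg (by omega), if_pos (by omega)]
      rfl
    rw [coord_mulVec_DL hn _ (by omega) (by omega), pathDL_additiveFun hn (by omega),
      pathDL_additiveFun hn (by split_ifs <;> omega), additiveFun, if_neg (by omega)]
    rfl
  | E6 =>
    refine sum_additiveFun_of_listMatrix (fun _ _ ↦ Iff.rfl) ?_ i
    change ∀ i : Fin 7, matE6.mulVec (fun i : Fin 7 ↦ (additiveFun E6 (i + 1) : ℤ)) i =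
      2 * (additiveFun E6 (i + 1) : ℤ)
    decide +kernel
  | E7 =>
    refine sum_additiveFun_of_listMatrix (fun _ _ ↦ Iff.rfl) ?_ i
    change ∀ i : Fin 8, matE7.mulVec (fun i : Fin 8 ↦ (additiveFun E7 (i + 1) : ℤ)) i =
      2 * (additiveFun E7 (i + 1) : ℤ)
    decide +kernel
  | E8 =>
    refine sum_additiveFun_of_listMatrix (fun _ _ ↦ Iff.rfl) ?_ i
    change ∀ i : Fin 9, matE8.mulVec (fun i : Fin 9 ↦ (additiveFun E8 (i + 1) : ℤ)) i =
      2 * (additiveFun E8 (i + 1) : ℤ)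
    decide +kernel

theorem exists_neighbour_of_label {X : TameDiagram} {i : Fin X.numVertices} (m : ℕ) (h1 : 1 ≤ m)
    (h2 : m ≤ X.numVertices) (hne : m ≠ i + 1) (h : X.Edge (i + 1) m ∨ X.Edge m (i + 1)) :
    ∃ j, j ≠ i ∧ X.adjacency i j = 1 := by
  obtain ⟨j, rfl⟩ : ∃ j : Fin X.numVertices, m = j + 1 := ⟨⟨m - 1, by omega⟩, by simp; omega⟩
  exact ⟨j, fun h ↦ hne (by rw [h]), adjacency_eq_one h⟩

/-- Every vertex has a neighbour other than itself. -/
theorem exists_neighbour (X : TameDiagram) (i : Fin X.numVertices) :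
    ∃ j, j ≠ i ∧ X.adjacency i j = 1 := by
  have key (l : ℕ → ℕ) (hl : ∀ i : Fin X.numVertices, 1 ≤ l (i + 1) ∧ l (i + 1) ≤ X.numVertices ∧
      l (i + 1) ≠ i + 1 ∧ (X.Edge (i + 1) (l (i + 1)) ∨ X.Edge (l (i + 1)) (i + 1))) :
      ∃ j, j ≠ i ∧ X.adjacency i j = 1 :=
    exists_neighbour_of_label (l (i + 1)) (hl i).1 (hl i).2.1 (hl i).2.2.1 (hl i).2.2.2
  cases X with
  | A n hn =>
    refine key (fun m ↦ if m = n + 1 then n else m + 1) fun i ↦ ?_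
    have : (i : ℕ) < n + 1 := i.2
    simp only [Edge, numVertices]
    split_ifs <;> omega
  | D n hn =>
    refine key (fun m ↦ if m ≤ 2 then 3 else if n ≤ m then n - 1 else m + 1) fun i ↦ ?_
    have : (i : ℕ) < n + 1 := i.2
    simp only [Edge, numVertices]
    split_ifs <;> omega
  | DL n hn =>
    refine key (fun m ↦ if m ≤ 2 then 3 else if m = 3 then 1 else m - 1) fun i ↦ ?_
    have : (i : ℕ) < n := i.2
    simp only [Edge, numVertices]
    split_ifs <;> omega
  | E6 =>
    -- The list gives one neighbour for each label, and the default serves the last label; likewise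
    -- for the other two diagrams.
    refine key (fun m ↦ [0, 2, 1, 2, 3, 4, 3].getD m 6) ?_
    simp only [Edge, numVertices]
    decide +kernel
  | E7 =>
    refine key (fun m ↦ [0, 2, 1, 2, 3, 4, 5, 3].getD m 1) ?_
    simp only [Edge, numVertices]
    decide +kernel
  | E8 =>
    refine key (fun m ↦ [0, 2, 1, 2, 3, 4, 5, 6, 3].getD m 7) ?_
    simp only [Edge, numVertices]
    decide +kernel

/-! ### Self-injectivity, and projective covers of simple modules. -/

section Algebra

variable {K : Type u} {Λ : Type v} [Field K] [Ring Λ] [Algebra K Λ] [FiniteDimensional K Λ]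

/-- A linear form whose kernel contains no nonzero left ideal represents every linear form. -/
theorem exists_eq_form_mul {ν : Λ →ₗ[K] K}
    (hI : ∀ I : Submodule Λ Λ, (∀ x ∈ I, ν x = 0) → I = ⊥) (f : Λ →ₗ[K] K) :
    ∃ c, ∀ x, ν (x * c) = f x := by
  let Φ : Λ →ₗ[K] Module.Dual K Λ := ((LinearMap.mul K Λ).compr₂ ν).flip
  have hΦ : Function.Injective Φ := by
    rw [injective_iff_map_eq_zero]
    intro c hc
    have : Submodule.span Λ {c} = ⊥ := by
      refine hI _ fun x hx ↦ ?_
      obtain ⟨a, rfl⟩ := Submodule.mem_span_singleton.mp hx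
      exact LinearMap.congr_fun hc a
    exact Submodule.span_singleton_eq_bot.mp this
  obtain ⟨c, hc⟩ := (LinearMap.injective_iff_surjective_of_finrank_eq_finrank
    (Subspace.dual_finrank_eq (K := K) (V := Λ)).symm).mp hΦ f
  exact ⟨c, fun x ↦ LinearMap.congr_fun hc x⟩

/-- Baer's criterion: given `g` on a left ideal, extend `ν ∘ g` to a linear form and write it as `ν
(· * c)`. Then `x * c - g x` generates a left ideal inside the kernel of `ν`, so `g` is right
multiplication by `c`. -/
theorem injective_of_form {ν : Λ →ₗ[K] K}
    (hI : ∀ I : Submodule Λ Λ, (∀ x ∈ I, ν x = 0) → I = ⊥) : Module.Injective Λ Λ := by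
  refine Module.Baer.injective fun I g ↦ ?_
  obtain ⟨f, hf⟩ := LinearMap.exists_extend (p := I.restrictScalars K)
    (ν.comp (g.restrictScalars K))
  obtain ⟨c, hc⟩ := exists_eq_form_mul hI f
  refine ⟨LinearMap.toSpanSingleton Λ Λ c, fun x hx ↦ ?_⟩
  have : Submodule.span Λ {x * c - g ⟨x, hx⟩} = ⊥ := by
    refine hI _ fun z hz ↦ ?_
    obtain ⟨a, rfl⟩ := Submodule.mem_span_singleton.mp hz
    have h1 : f (a * x) = ν (g (a • ⟨x, hx⟩)) := LinearMap.congr_fun hf (a • ⟨x, hx⟩)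
    rw [map_smul, ← hc] at h1
    rw [smul_sub, map_sub, smul_eq_mul, ← mul_assoc, h1, sub_self]
  exact sub_eq_zero.mp (Submodule.span_singleton_eq_bot.mp this)

theorem rad_top_of_isSimpleModule (S : Type*) [AddCommGroup S] [Module Λ S] [IsSimpleModule Λ S] :
    rad (⊤ : Submodule Λ S) = ⊥ := rad_top_of_isSemisimpleModule

/-- Every simple module is the top of an indecomposable projective module. -/
theorem exists_idempotent_top_equiv (K : Type u) {Λ : Type v} [Field K] [Ring Λ] [Algebra K Λ]
    [FiniteDimensional K Λ] (S : Type*) [AddCommGroup S] [Module Λ S]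
    [IsSimpleModule Λ S] :
    ∃ e : Λ, e * e = e ∧ ∃ p : proj e →ₗ[Λ] S, Function.Surjective p ∧
      LinearMap.ker p = rad ⊤ := by
  have : IsArtinianRing Λ := IsArtinianRing.of_finite K Λ
  have := IsSimpleModule.nontrivial Λ S
  obtain ⟨s, hs⟩ := exists_ne (0 : S)
  set π := LinearMap.toSpanSingleton Λ S s
  have hπ : Function.Surjective π := IsSimpleModule.toSpanSingleton_surjective Λ hs
  obtain ⟨L, hL, hmin⟩ := (wellFounded_lt (α := Submodule Λ Λ)).has_min
    {L | L.map π = ⊤} ⟨⊤, by simpa [LinearMap.range_eq_top] using hπ⟩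
  have hmin' : ∀ X ≤ L, X.map π = ⊤ → X = L := fun X hX h ↦ by
    by_contra hne
    exact hmin X h (lt_of_le_of_ne hX hne)
  set p : L →ₗ[Λ] S := π.comp L.subtype
  have hp : Function.Surjective p := by
    rw [← LinearMap.range_eq_top, LinearMap.range_comp, Submodule.range_subtype]
    exact hL
  -- `L` is minimal among left ideals mapping onto `S`, so the lift `h : Λ → L` is bijective on `L`.
  -- Correcting by the inverse `φ.symm` gives a retraction of `Λ` onto `L`; the idempotent is the
  -- image of 1.
  obtain ⟨h, hh⟩ := Module.projective_lifting_property p π hp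
  have hsurj : Function.Surjective (h.comp L.subtype) := by
    have h1 : (LinearMap.range (h.comp L.subtype)).map L.subtype = L := by
      refine hmin' _ (Submodule.map_subtype_le _ _) ?_
      rw [← Submodule.map_comp, ← LinearMap.range_comp, ← LinearMap.comp_assoc, hh]
      exact LinearMap.range_eq_top.mpr hp
    rw [← LinearMap.range_eq_top]
    refine Submodule.map_injective_of_injective L.injective_subtype ?_
    rw [h1, Submodule.map_top, Submodule.range_subtype]
  have hinj : Function.Injective (h.comp L.subtype) :=
    (LinearMap.injective_iff_surjective (f := (h.comp L.subtype).restrictScalars K)).mpr hsurj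
  let φ := LinearEquiv.ofBijective _ ⟨hinj, hsurj⟩
  have hr (x : L) : φ.symm (h x) = x := φ.symm_apply_apply x
  have he (x : L) : (x : Λ) * φ.symm (h 1) = x := by
    conv_rhs => rw [← hr x]
    rw [← smul_eq_mul, ← Submodule.coe_smul, ← map_smul, ← map_smul, smul_eq_mul, mul_one]
  have hLe : proj (φ.symm (h 1) : Λ) = L := by
    refine le_antisymm ((Submodule.span_singleton_le_iff_mem _ _).mpr (φ.symm (h 1)).2) ?_
    intro x hx
    exact Submodule.mem_span_singleton.mpr ⟨x, he ⟨x, hx⟩⟩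
  refine ⟨φ.symm (h 1), he _, ?_⟩
  rw [hLe]
  refine ⟨p, hp, le_antisymm (le_trans ?_ jacobson_le_rad) ?_⟩
  -- A maximal submodule of `L` not containing the kernel would still map onto `S`, against
  -- minimality of `L`.
  · refine le_sInf fun m hm ↦ ?_
    by_contra hle
    have h1 : m ⊔ LinearMap.ker p = ⊤ := hm.2 _ (left_lt_sup.mpr hle)
    have h2 : m.map p = ⊤ := by
      have := congrArg (Submodule.map p) h1
      rwa [Submodule.map_sup, LinearMap.le_ker_iff_map.mp le_rfl, sup_bot_eq,
        Submodule.map_top, LinearMap.range_eq_top.mpr hp] at this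
    refine hm.1 (Submodule.map_injective_of_injective L.injective_subtype ?_)
    rw [Submodule.map_top, Submodule.range_subtype]
    refine hmin' _ (Submodule.map_subtype_le _ _) ?_
    rw [← Submodule.map_comp]
    exact h2
  · rw [LinearMap.le_ker_iff_map, ← le_bot_iff, ← rad_top_of_isSimpleModule (Λ := Λ) S]
    exact map_rad_top_le p

end Algebra

/-! ### `Ext¹` through projective covers. -/

section Ext

open Abelian

variable {K : Type u} {Λ : Type v} [Field K] [Ring Λ] [Algebra K Λ]

open scoped ModuleCat in
/-- The first extension group of a module `S` with projective cover `P`, with values in a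
semisimple module. -/
theorem finrank_ext_one (S T : ModuleCat.{v} Λ) {P : Type v} [AddCommGroup P]
    [Module Λ P] [Module.Projective Λ P] (p : P →ₗ[Λ] S) (hp : Function.Surjective p)
    (hker : LinearMap.ker p = rad ⊤) (hT : rad (⊤ : Submodule Λ T) = ⊥) (N : Type v)
    [AddCommGroup N] [Module Λ N] [Module K N] [IsScalarTower K Λ N] (ψ : N ≃ₗ[Λ] T) :
    Module.finrank K (rad (⊤ : Submodule Λ P) →ₗ[Λ] N) = Module.finrank K (Ext.{v} S T 1) := by
  rw [← hker]
  let C := p.shortComplexKer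
  have hC : C.ShortExact := LinearMap.shortExact_shortComplexKer hp
  have : Projective C.X₂ := (IsProjective.iff_projective (R := Λ) P).mp inferInstance
  let F : (LinearMap.ker p →ₗ[Λ] N) →ₗ[K] Ext.{v} S T 1 :=
    { toFun f := hC.extClass.comp
        (Ext.mk₀ (ModuleCat.ofHom (ψ.toLinearMap.comp f) : C.X₁ ⟶ T)) (add_zero 1)
      map_add' f g := by
        rw [← Ext.comp_add, ← Ext.mk₀_add]
        congr 2
        ext x
        exact map_add ψ _ _
      map_smul' c f := by
        rw [RingHom.id_apply, ← Ext.comp_smul, ← Ext.mk₀_smul]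
        congr 2
        ext x
        exact ψ.toLinearMap.map_smul_of_tower c (f x) }
  refine (LinearEquiv.ofBijective F ⟨?_, ?_⟩).finrank_eq
  · rw [injective_iff_map_eq_zero]
    intro f hf
    obtain ⟨x, hx⟩ := Ext.contravariant_sequence_exact₁ hC T _ (add_zero 1) hf
    obtain ⟨g, rfl⟩ := (Ext.mk₀_bijective _ _).2 x
    rw [Ext.mk₀_comp_mk₀] at hx
    have hx' := (Ext.mk₀_bijective _ _).1 hx
    ext y
    have h1 : g.hom y = ψ (f y) := LinearMap.congr_fun (congrArg ModuleCat.Hom.hom hx') y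
    -- A map from `P` to `T` kills `rad P`, so the connecting map from `Hom(rad P, T)` to `Ext¹` is
    -- injective; it is onto because `Ext¹(P, T) = 0`.
    have h2 : g.hom y ∈ (⊥ : Submodule Λ T) := by
      rw [← hT]
      exact map_rad_top_le g.hom ⟨y, hker.le y.2, rfl⟩
    rw [(Submodule.mem_bot Λ).mp h2] at h1
    exact (ψ.map_eq_zero_iff.mp h1.symm)
  · intro x
    obtain ⟨y, hy⟩ := Ext.contravariant_sequence_exact₃ hC T x (Ext.eq_zero_of_projective _)
      (add_zero 1)
    obtain ⟨g, rfl⟩ := (Ext.mk₀_bijective _ _).2 y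
    refine ⟨ψ.symm.toLinearMap.comp g.hom, ?_⟩
    rw [← hy]
    change hC.extClass.comp (Ext.mk₀ _) (add_zero 1) = _
    congr 2
    ext z
    exact ψ.apply_symm_apply _

end Ext

/-! ### From simple modules and `Ext¹` to a basic system. -/

section Hom

variable (K : Type u) {Λ : Type v} [Field K] [Ring Λ] [Algebra K Λ]
  {M N : Type*} [AddCommGroup M] [Module Λ M] [Module K M] [IsScalarTower K Λ M]
  [AddCommGroup N] [Module Λ N] [Module K N] [IsScalarTower K Λ N]

/-- Maps from `Λ e` to `M` correspond to elements of `e M`. -/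
theorem mult_eq_finrank_proj {e : Λ} (he : e * e = e) :
    mult K e M = Module.finrank K (proj e →ₗ[Λ] M) := by
  have hmem : e ∈ proj e := Submodule.mem_span_singleton_self e
  refine LinearEquiv.finrank_eq
    { toFun m := (LinearMap.toSpanSingleton Λ M (m : M)).comp (proj e).subtype
      map_add' m n := by
        ext x
        exact smul_add _ _ _
      map_smul' c m := by
        ext x
        exact smul_comm _ _ _
      invFun f := ⟨f ⟨e, hmem⟩, (mem_range_lsmul_iff K he).mpr
        (by rw [← map_smul]; exact congrArg f (Subtype.ext he))⟩
      left_inv m := Subtype.ext ((mem_range_lsmul_iff K he).mp m.2)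
      right_inv f := by
        ext x
        change (x : Λ) • f ⟨e, hmem⟩ = f x
        rw [← map_smul]
        exact congrArg f (Subtype.ext ((mem_proj_iff he).mp x.2)) }

/-- Maps to a module annihilated by the radical factor through the top. -/
theorem finrank_hom_top (hN : rad (⊤ : Submodule Λ N) = ⊥) :
    Module.finrank K ((M ⧸ rad (⊤ : Submodule Λ M)) →ₗ[Λ] N) = Module.finrank K (M →ₗ[Λ] N) := by
  refine LinearEquiv.finrank_eq
    { toFun f := f.comp (Submodule.mkQ _)
      map_add' f g := rfl
      map_smul' c f := rfl
      invFun f := (rad (⊤ : Submodule Λ M)).liftQ f (by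
        rw [LinearMap.le_ker_iff_map, ← le_bot_iff, ← hN]
        exact map_rad_top_le f)
      left_inv f := by ext x; rfl
      right_inv f := by ext x; rfl }

theorem mult_eq_finrank_top {e : Λ} (he : e * e = e) (hM : rad (⊤ : Submodule Λ M) = ⊥) :
    mult K e M = Module.finrank K (top e →ₗ[Λ] M) :=
  (mult_eq_finrank_proj K he).trans (finrank_hom_top K hM).symm

theorem finrank_hom_congr {M' : Type*} [AddCommGroup M'] [Module Λ M'] (φ : M ≃ₗ[Λ] M') :
    Module.finrank K (M' →ₗ[Λ] N) = Module.finrank K (M →ₗ[Λ] N) :=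
  LinearEquiv.finrank_eq
    { toFun f := f.comp φ.toLinearMap
      map_add' f g := rfl
      map_smul' c f := rfl
      invFun f := f.comp φ.symm.toLinearMap
      left_inv f := by ext x; simp
      right_inv f := by ext x; simp }

end Hom

/-- The data of representatives of the simple modules of `Λ`, given as the tops of indecomposable
projective modules, with the dimensions of the extension groups prescribed by the symmetric
matrix `E`. -/
structure IsSimpleSystem (K : Type u) {Λ : Type v} [Field K] [Ring Λ] [Algebra K Λ]
    {ι : Type*} [DecidableEq ι] (e : ι → Λ) (E : Matrix ι ι ℕ) : Prop where
  idem : ∀ i, e i * e i = e i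
  simple : ∀ i, IsSimpleModule Λ (top (e i))
  eq_of_equiv : ∀ i j, Nonempty (top (e i) ≃ₗ[Λ] top (e j)) → i = j
  exists_equiv : ∀ (T : Type v) [AddCommGroup T] [Module Λ T] [IsSimpleModule Λ T],
    ∃ i, Nonempty (T ≃ₗ[Λ] top (e i))
  finrank_hom : ∀ i j,
    Module.finrank K (rad (⊤ : Submodule Λ (proj (e i))) →ₗ[Λ] top (e j)) = E i j

namespace IsSimpleSystem

variable {K : Type u} {Λ : Type v} [Field K] [Ring Λ] [Algebra K Λ] [FiniteDimensional K Λ]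
  {ι : Type*} [Fintype ι] [DecidableEq ι] {e : ι → Λ} {E : Matrix ι ι ℕ}

/-- This gives splitness without assuming `K` algebraically closed. A nonzero map `f` from `rad (Λ
(e i))` to the simple module is surjective, so `g ↦ g ∘ f` embeds its endomorphism ring in a
one-dimensional space. -/
theorem finrank_end (hs : IsSimpleSystem K e E) {i j : ι} (h : E i j = 1) :
    Module.finrank K (top (e j) →ₗ[Λ] top (e j)) = 1 := by
  have := hs.simple j
  have := IsSimpleModule.nontrivial Λ (top (e j))
  have hfin : FiniteDimensional K (top (e j) →ₗ[Λ] top (e j)) := inferInstance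
  have hfin' : FiniteDimensional K (rad (⊤ : Submodule Λ (proj (e i))) →ₗ[Λ] top (e j)) :=
    inferInstance
  have h1 := hs.finrank_hom i j
  rw [h] at h1
  obtain ⟨f, hf, -⟩ := finrank_eq_one_iff'.mp h1
  have hsurj := LinearMap.surjective_of_ne_zero hf
  refine le_antisymm ?_ ?_
  · rw [← h1]
    refine LinearMap.finrank_le_finrank_of_injective (f :=
      { toFun g := g.comp f
        map_add' g g' := rfl
        map_smul' c g := rfl }) fun g g' hg ↦ ?_
    exact (LinearMap.cancel_right hsurj).mp hg
  · exact Module.finrank_pos_iff_exists_ne_zero.mpr ⟨LinearMap.id, fun h0 ↦ by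
      obtain ⟨x, hx⟩ := exists_ne (0 : top (e j))
      exact hx (LinearMap.congr_fun h0 x)⟩

theorem eq_zero_of_ne (hs : IsSimpleSystem K e E) {i j : ι} (h : i ≠ j)
    (f : top (e i) →ₗ[Λ] top (e j)) : f = 0 := by
  have := hs.simple i
  have := hs.simple j
  by_contra hf
  exact h (hs.eq_of_equiv i j ⟨LinearEquiv.ofBijective f (LinearMap.bijective_of_ne_zero hf)⟩)

theorem finrank_hom_top_top (hs : IsSimpleSystem K e E) (hE : ∀ i, ∃ j, j ≠ i ∧ E j i = 1)
    (i j : ι) : Module.finrank K (top (e i) →ₗ[Λ] top (e j)) = if i = j then 1 else 0 := by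
  split_ifs with h
  · subst h
    obtain ⟨j, -, hj⟩ := hE i
    exact hs.finrank_end hj
  · have : Subsingleton (top (e i) →ₗ[Λ] top (e j)) :=
      ⟨fun f g ↦ by rw [hs.eq_zero_of_ne h f, hs.eq_zero_of_ne h g]⟩
    exact Module.finrank_zero_of_subsingleton

theorem mult_top (hs : IsSimpleSystem K e E) (hE : ∀ i, ∃ j, j ≠ i ∧ E j i = 1) (i j : ι) :
    mult K (e j) (top (e i)) = if i = j then 1 else 0 := by
  rw [mult_eq_finrank_top K (hs.idem j) rad_top_quotient_rad, hs.finrank_hom_top_top hE]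
  simp only [eq_comm]

theorem finrank_hom_semisimple (hs : IsSimpleSystem K e E) (hE : ∀ i, ∃ j, j ≠ i ∧ E j i = 1)
    (j : ι) (Z : Type v) [AddCommGroup Z] [Module Λ Z] [Module K Z] [IsScalarTower K Λ Z]
    [FiniteDimensional K Z] (hZ : rad (⊤ : Submodule Λ Z) = ⊥) :
    Module.finrank K (Z →ₗ[Λ] top (e j)) = mult K (e j) Z := by
  obtain ⟨n, σ, ⟨φ⟩⟩ := exists_equiv_pi_of_simple K hs.exists_equiv Z hZ
  rw [← finrank_hom_congr K φ, mult_congr K _ φ, mult_pi,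
    ← (LinearMap.lsum Λ (fun k ↦ top (e (σ k))) K).finrank_eq, Module.finrank_pi_fintype]
  refine Finset.sum_congr rfl fun k _ ↦ ?_
  rw [hs.finrank_hom_top_top hE, hs.mult_top hE]

theorem mult_rad_quotient (hs : IsSimpleSystem K e E) (hE : ∀ i, ∃ j, j ≠ i ∧ E j i = 1)
    (i j : ι) :
    mult K (e j) (rad (⊤ : Submodule Λ (proj (e i))) ⧸
      rad (⊤ : Submodule Λ (rad (⊤ : Submodule Λ (proj (e i)))))) = E i j := by
  rw [← hs.finrank_hom_semisimple hE j _ rad_top_quotient_rad,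
    finrank_hom_top K rad_top_quotient_rad, hs.finrank_hom]

section Socle

variable {ν : Λ →ₗ[K] K} (hν : ∀ a b : Λ, ν (a * b) = ν (b * a))
  (hI : ∀ I : Submodule Λ Λ, (∀ x ∈ I, ν x = 0) → I = ⊥)

include hν hI in
-- Send `φ` to `ν ∘ φ` on `e j T`. Since `φ m = φ m * e j`, symmetry gives `ν (φ m) = ν (φ (e j •
-- m))`. If this form vanishes, the image of `φ` is a left ideal in the kernel of `ν`, hence zero.
theorem finrank_hom_proj_le (hs : IsSimpleSystem K e E) (T : Type v) [AddCommGroup T] [Module Λ T]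
    [Module K T] [IsScalarTower K Λ T] [FiniteDimensional K T] (j : ι) :
    Module.finrank K (T →ₗ[Λ] proj (e j)) ≤ mult K (e j) T := by
  let U := LinearMap.range (Algebra.lsmul K K T (e j))
  let F : (T →ₗ[Λ] proj (e j)) →ₗ[K] Module.Dual K U :=
    { toFun φ := (ν.comp (((proj (e j)).subtype.comp φ).restrictScalars K)).comp U.subtype
      map_add' φ ψ := by
        ext x
        exact map_add ν _ _
      map_smul' c φ := by
        ext x
        exact map_smul ν _ _ }
  have hF : Function.Injective F := by
    rw [injective_iff_map_eq_zero]
    intro φ hφ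
    have h0 (m : T) : ν (φ m) = 0 := by
      have h1 : ν (φ (e j • m)) = 0 := LinearMap.congr_fun hφ ⟨_, m, rfl⟩
      rw [map_smul, Submodule.coe_smul, smul_eq_mul, hν,
        (mem_proj_iff (hs.idem j)).mp (φ m).2] at h1
      exact h1
    have h2 : LinearMap.range ((proj (e j)).subtype.comp φ) = ⊥ := by
      refine hI _ ?_
      rintro _ ⟨m, rfl⟩
      exact h0 m
    ext m
    exact LinearMap.congr_fun (LinearMap.range_eq_bot.mp h2) m
  refine (LinearMap.finrank_le_finrank_of_injective hF).trans_eq ?_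
  exact Subspace.dual_finrank_eq

include hν hI in
/-- The socle of an indecomposable projective module is simple and isomorphic to the top. -/
theorem exists_socle (hs : IsSimpleSystem K e E) (hE : ∀ i, ∃ j, j ≠ i ∧ E j i = 1) (j : ι) :
    ∃ A : Submodule Λ (proj (e j)), IsAtom A ∧ Nonempty (top (e j) ≃ₗ[Λ] A) ∧
      ∀ X : Submodule Λ (proj (e j)), rad X = ⊥ → X ≤ A := by
  have : IsArtinianRing Λ := IsArtinianRing.of_finite K Λ
  have := hs.simple j
  have := IsSimpleModule.nontrivial Λ (top (e j))
  have : Nontrivial (proj (e j)) := 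
    (Submodule.mkQ_surjective (rad (⊤ : Submodule Λ (proj (e j))))).nontrivial
  have hle (i : ι) : Module.finrank K (top (e i) →ₗ[Λ] proj (e j)) ≤ if i = j then 1 else 0 :=
    (hs.finrank_hom_proj_le hν hI _ j).trans_eq (hs.mult_top hE i j)
  have hequiv (B : Submodule Λ (proj (e j))) (hB : IsAtom B) : Nonempty (top (e j) ≃ₗ[Λ] B) := by
    have := isSimpleModule_iff_isAtom.mpr hB
    obtain ⟨i, ⟨φ⟩⟩ := hs.exists_equiv B
    by_cases hij : i = j
    · subst hij
      exact ⟨φ.symm⟩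
    · have h1 := hle i
      rw [if_neg hij, Nat.le_zero] at h1
      have h2 := Module.finrank_zero_iff.mp h1
      have h3 : B.subtype.comp φ.symm.toLinearMap = 0 := Subsingleton.elim _ _
      refine absurd ?_ hB.1
      rw [← B.range_subtype, ← LinearMap.range_comp_of_range_eq_top B.subtype φ.symm.range, h3,
        LinearMap.range_zero]
  obtain ⟨A, hA⟩ := IsAtomic.exists_atom (Submodule Λ (proj (e j)))
  obtain ⟨φ⟩ := hequiv A hA
  have hrange (B : Submodule Λ (proj (e j))) (ψ : top (e j) ≃ₗ[Λ] B) :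
      LinearMap.range (B.subtype.comp ψ.toLinearMap) = B := by
    rw [LinearMap.range_comp_of_range_eq_top B.subtype ψ.range, B.range_subtype]
  have hne : A.subtype.comp φ.toLinearMap ≠ 0 := fun h0 ↦ hA.1 (by
    rw [← hrange A φ, h0, LinearMap.range_zero])
  have h1 : Module.finrank K (top (e j) →ₗ[Λ] proj (e j)) = 1 := by
    refine le_antisymm (by simpa using hle j) ?_
    exact Module.finrank_pos_iff_exists_ne_zero.mpr ⟨_, hne⟩
  -- Every atom is an image of `top (e j)`, and the maps from that module form a line over `K`; so
  -- there is only one atom.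
  have hatom (B : Submodule Λ (proj (e j))) (hB : IsAtom B) : B ≤ A := by
    obtain ⟨ψ⟩ := hequiv B hB
    obtain ⟨c, hc⟩ := exists_smul_eq_of_finrank_eq_one h1 hne (B.subtype.comp ψ.toLinearMap)
    rw [← hrange B ψ, ← hc]
    rintro _ ⟨x, rfl⟩
    exact (A.restrictScalars K).smul_mem c (φ x).2
  refine ⟨A, hA, ⟨φ⟩, fun X hX ↦ ?_⟩
  have := isSemisimpleModule_submodule hX
  rw [← Submodule.comap_subtype_eq_top, eq_top_iff,
    ← IsSemisimpleModule.sSup_simples_eq_top Λ X]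
  refine sSup_le fun m hm ↦ Submodule.map_le_iff_le_comap.mp (hatom _ ?_)
  have : IsSimpleModule Λ m := hm
  rw [← isSimpleModule_iff_isAtom]
  exact IsSimpleModule.congr (N := m) (Submodule.equivMapOfInjective _ X.injective_subtype m).symm

include hν hI in
/-- A system of representatives of the simple modules of a symmetric algebra with radical cube
zero is a basic system. -/
theorem isBasicSystem (hs : IsSimpleSystem K e E) (hJ : Ring.jacobson Λ ^ 3 = ⊥)
    (hE : ∀ i, ∃ j, j ≠ i ∧ E j i = 1) (hsymm : ∀ i j, E i j = E j i) :
    IsBasicSystem K e E := by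
  have hsocle (j : ι) : Nonempty (top (e j) ≃ₗ[Λ] rad (rad (⊤ : Submodule Λ (proj (e j))))) ∧
      ∀ X : Submodule Λ (proj (e j)), rad X = ⊥ → X ≤ rad (rad ⊤) := by
    obtain ⟨A, hA, ⟨φ⟩, hmax⟩ := hs.exists_socle hν hI hE j
    obtain ⟨k, hkj, hk⟩ := hE j
    -- `J²` lies in the simple socle `A`. If it vanished, the radical would lie in `A` and be zero
    -- or isomorphic to `top (e j)`, leaving no nonzero map to the simple module of a neighbour `k ≠
    -- j`.
    have hRA : rad (rad ⊤) = A := by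
      refine (hA.le_iff.mp (hmax _ (rad_rad_rad hJ _))).resolve_left fun h0 ↦ ?_
      have h1 := hs.finrank_hom j k
      rw [hsymm, hk] at h1
      have h2 : Subsingleton (rad (⊤ : Submodule Λ (proj (e j))) →ₗ[Λ] top (e k)) := by
        rcases hA.le_iff.mp (hmax _ h0) with h | h
        · rw [h]
          infer_instance
        · rw [h]
          refine ⟨fun f g ↦ ?_⟩
          rw [← LinearMap.cancel_right φ.surjective]
          exact (hs.eq_zero_of_ne hkj.symm (f.comp φ.toLinearMap)).trans
            (hs.eq_zero_of_ne hkj.symm (g.comp φ.toLinearMap)).symm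
      rw [Module.finrank_zero_of_subsingleton] at h1
      exact zero_ne_one h1
    rw [hRA]
    exact ⟨⟨φ⟩, hmax⟩
  have : IsArtinianRing Λ := IsArtinianRing.of_finite K Λ
  exact
    { jacobson_pow := hJ
      idem := hs.idem
      injective := injective_of_form hI
      exists_equiv := hs.exists_equiv
      mult_top := hs.mult_top hE
      mult_rad := fun i j ↦ by
        rw [← mult_submodule_add K (hs.idem j)
          (rad (⊤ : Submodule Λ (rad (⊤ : Submodule Λ (proj (e i)))))), hs.mult_rad_quotient hE,
          ← mult_map_of_injective K (e j) (Submodule.injective_subtype _), map_subtype_rad_top,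
          ← mult_congr K (e j) (hsocle i).1.some, hs.mult_top hE]
      socle_le := fun j ↦ (hsocle j).2
      socle_equiv := fun j ↦ (hsocle j).1 }

end Socle

end IsSimpleSystem

/-! ### Assembly for the resolution. -/

section Main

variable {K : Type u} {Λ : Type v} [Field K] [Ring Λ] [Algebra K Λ] [FiniteDimensional K Λ]

theorem exists_isSimpleSystem {X : TameDiagram} (hX : IsOfType K Λ X) :
    ∃ e : Fin X.numVertices → Λ, IsSimpleSystem K e X.adjacency := by
  obtain ⟨S, hS, hiso, hex, hext⟩ := hX
  choose e he p hp hker using fun i ↦ exists_idempotent_top_equiv (Λ := Λ) K (S i)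
  have φ (i) : top (e i) ≃ₗ[Λ] S i :=
    Submodule.quotEquivOfEq _ _ (hker i).symm ≪≫ₗ (p i).quotKerEquivOfSurjective (hp i)
  refine ⟨e, he, fun i ↦ IsSimpleModule.congr (φ i), fun i j ⟨ψ⟩ ↦
    hiso i j ⟨(φ i).symm ≪≫ₗ ψ ≪≫ₗ φ j⟩, fun T _ _ hT ↦ ?_, fun i j ↦ ?_⟩
  · obtain ⟨i, ⟨ψ⟩⟩ := hex (ModuleCat.of Λ T) hT
    exact ⟨i, ⟨ψ ≪≫ₗ (φ i).symm⟩⟩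
  · have := projective_proj (he i)
    have hT : rad (⊤ : Submodule Λ (S j)) = ⊥ := rad_top_of_isSemisimpleModule
    rw [finrank_ext_one (S i) (S j) (p i) (hp i) (hker i) hT _ (φ j)]
    exact Module.finrank_eq_of_rank_eq (hext i j)

theorem exists_isBasicSystem (hsymm : IsSymmetricFrobeniusAlgebra K Λ)
    (hrad : Ring.jacobson Λ ^ 3 = ⊥) {X : TameDiagram} (hX : IsOfType K Λ X) :
    ∃ e : Fin X.numVertices → Λ, IsBasicSystem K e X.adjacency := by
  obtain ⟨ν, hν, hI, -⟩ := hsymm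
  obtain ⟨e, he⟩ := exists_isSimpleSystem hX
  refine ⟨e, he.isBasicSystem hν hI hrad (fun i ↦ ?_) (adjacency_symm X)⟩
  obtain ⟨j, hj, h⟩ := exists_neighbour X i
  exact ⟨j, hj, (adjacency_symm X j i).trans h⟩

open scoped ModuleCat in
/-- The terms of a minimal projective resolution of a simple module over a radical cube zero
algebra of tame type. -/
theorem exists_multiplicities {X : TameDiagram} {e : Fin X.numVertices → Λ}
    (hs : IsBasicSystem K e X.adjacency) {S : ModuleCat.{v} Λ} (hS : IsSimpleModule Λ S)
    (R : ProjectiveResolution S) (hR : IsMinimalResolution R) :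
    ∃ t : ℕ → Fin X.numVertices → ℕ, t 1 = Matrix.vecMul (t 0) X.adjacency ∧
      (∀ n, t (n + 2) + t n = Matrix.vecMul (t (n + 1)) X.adjacency) ∧
      ∀ n, Nonempty (R.complex.X n ≃ₗ[Λ] stdProj e (t n)) := by
  have : IsArtinianRing Λ := IsArtinianRing.of_finite K Λ
  have (n : ℕ) : Module.Projective Λ (R.complex.X n) :=
    (IsProjective.iff_projective _).mpr (R.projective n)
  have : IsSimpleModule Λ (((ChainComplex.single₀ (ModuleCat.{v} Λ)).obj S).X 0) := hS
  obtain ⟨i, t, -, h1, h2, h3⟩ := hs.exists_recurrence (P := fun n ↦ R.complex.X n)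
    (δ := fun i : Fin X.numVertices ↦ additiveFun X (i + 1)) (sum_additiveFun X) (additiveFun_pos X)
    (R.π.f 0).hom (fun n ↦ (R.complex.d (n + 1) n).hom)
    ((ModuleCat.epi_iff_surjective _).mp inferInstance)
    R.exact₀.moduleCat_range_eq_ker (fun n ↦ (R.exact_succ n).moduleCat_range_eq_ker)
    fun n ↦ (hR n).trans jacobson_le_rad
  exact ⟨t, h1, h2, h3⟩

/-- The module `N` is `R (q - 1)` or `R (q - 2) ⊕ R 0`, according to the form of `w`. -/
theorem hasLinearGrowth_of_multiplicities {ι : Type*} [Fintype ι] [DecidableEq ι] {e : ι → Λ}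
    {S : ModuleCat.{v} Λ} {R : ProjectiveResolution S} {q : ℕ} {t : ℕ → ι → ℕ}
    (ht : ∀ n, Nonempty (R.complex.X n ≃ₗ[Λ] stdProj e (t n)))
    (h : ∀ l, ∃ w : ι → ℕ, (w = t (q - 1) ∨ w = t (q - 2) + t 0) ∧
      ∀ k : ℕ, t (k * q + l) = k • w + t l) : HasLinearGrowth R q := by
  intro l _
  obtain ⟨w, hw, hk⟩ := h l
  obtain ⟨m, i, hi, hsum⟩ : ∃ (m : ℕ) (i : Fin (m + 1) → ℕ), (∀ j, i j ≤ q) ∧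
      ∑ j, t (i j) = w := by
    rcases hw with rfl | rfl
    · exact ⟨0, fun _ ↦ q - 1, fun _ ↦ Nat.sub_le q 1, by simp⟩
    · exact ⟨1, ![q - 2, 0], by simp [Fin.forall_fin_two], by simp [Fin.sum_univ_two]⟩
  refine ⟨ModuleCat.of Λ ((j : Fin (m + 1)) → R.complex.X (i j)),
    ⟨m, i, hi, ⟨LinearEquiv.refl _ _⟩⟩, fun k ↦ ?_⟩
  obtain ⟨φ⟩ := nonempty_pi_stdProj e fun j ↦ t (i j)
  rw [hsum] at φ
  obtain ⟨ψ⟩ := nonempty_pi_stdProj e fun _ : Fin k ↦ w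
  rw [Finset.sum_const, Finset.card_univ, Fintype.card_fin] at ψ
  obtain ⟨χ⟩ := nonempty_prod_stdProj e (k • w) (t l)
  rw [← hk] at χ
  let θ : ((j : Fin (m + 1)) → R.complex.X (i j)) ≃ₗ[Λ] stdProj e w :=
    LinearEquiv.piCongrRight (fun j ↦ (ht (i j)).some) ≪≫ₗ φ
  exact ⟨(ht _).some ≪≫ₗ χ.symm ≪≫ₗ
    LinearEquiv.prodCongr (ψ.symm ≪≫ₗ LinearEquiv.piCongrRight fun _ ↦ θ.symm) (ht l).some.symm⟩

end Main

end RadicalCube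

theorem mainTheorem6 {K : Type u} {Λ : Type v} [Field K] [Ring Λ] [Algebra K Λ]
    [FiniteDimensional K Λ] (hsymm : IsSymmetricFrobeniusAlgebra K Λ)
    (hrad : Ring.jacobson Λ ^ 3 = ⊥)
    (X : TameDiagram) (hX : IsOfType K Λ X)
    (S : ModuleCat.{v} Λ) (hS : IsSimpleModule Λ S)
    (R : ProjectiveResolution S) (hR : IsMinimalResolution R) :
    HasLinearGrowth R X.q := by
  obtain ⟨e, he⟩ := RadicalCube.exists_isBasicSystem hsymm hrad hX
  obtain ⟨t, h1, h2, h3⟩ := RadicalCube.exists_multiplicities he hS R hR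
  obtain ⟨c0, c1⟩ := RadicalCube.chebC_adj X
  exact RadicalCube.hasLinearGrowth_of_multiplicities h3
    (RadicalCube.exists_growth (RadicalCube.two_le_q X) h1 h2 c0 c1)
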